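/- Let $h\neq 0$ be a real or complex constant, let $t=(\bar t_1,\bar t_2,\dots)$ be real time variables, and write $\bar x=\bar t_1$, $E f_n=f_{n+1}$, $\Delta=E-1$, $\Delta^{-1}f_n=\sum_{k<n}f_k$. Composition of pseudo-difference operators $\sum_{j\le m}p_{j,n}\Delta^j$ is given by the Leibniz rule $\Delta^s g_n=\sum_{i\ge 0}\binom{s}{i}(\Delta^i g_{n+s-i})\Delta^{s-i}$, $s\in\mathbb Z$; $(\cdot)_{\ge1}$ is the part with positive powers of $\Delta$, and $*$ is the formal adjoint for $\sum_n f_ng_n$, so $\Delta^*=E^{-1}-1$. Let $\Phi=\Phi_n(t)$ and $\Phi^*=\Phi^*_n(t)$, real- or complex-valued, be defined for $n\in\mathbb Z$ and for $t$ in a set $U$ of times that is open along every coordinate direction, and let them decrease rapidly as $|n|\to\infty$, locally uniformly along every time direction. Put $$a_n=\Phi_n,\qquad b_n=hE\Delta^{-1}\Phi^*_n,$$ and impose the constraint $\tilde v=h\Phi E\Delta^{-1}\Phi^*=a_nb_n$, $\bar v=1+h\tilde v=1+ha_nb_n$, where $\bar v$ vanishes nowhere. Let $$\bar L=h^{-1}\bar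 v\Delta+\bar v_0+h\bar v_1\Delta^{-1}+h^2\bar v_2\Delta^{-2}+\cdots,\qquad \bar A_s=(\bar L^s)_{\ge 1},$$ where the $\bar v_j$ are determined by $\bar L_{\bar x}=[\bar A_1,\bar L]$ and $\bar v_j\to0$ as $n\to-\infty$. Suppose that $$\Phi_{\bar t_s}=\bar A_s\Phi,\qquad \Phi^*_{\bar t_s}=-\bar A_s^*\Phi^*,\qquad s=1,2,\dots$$ Then $a_n,b_n$ are differentiable in every $\bar t_s$ and satisfy $$a_{n,\bar t_1}=h^{-1}(1+ha_nb_n)(a_{n+1}-a_n),\qquad b_{n,\bar t_1}=h^{-1}(1+ha_nb_n)(b_n-b_{n-1}),$$ $$\begin{pmatrix}a_n\\ b_n\end{pmatrix}_{\bar t_{s+1}}=\bar T\begin{pmatrix}a_n\\ b_n\end{pmatrix}_{\bar t_s},\qquad \bar T=\begin{pmatrix}\bar T_{11}&\bar T_{12}\\ \bar T_{21}&\bar T_{22}\end{pmatrix},\qquad s=1,2,\dots,$$ where all sums $\Delta^{-1}$ that occur converge absolutely, and the entries are $$\bar T_{11}=h^{-1}(ha_nb_n\Delta+\Delta+ha_n\Delta^{-1}b_n\Delta)+h^{-1}(ha_nb_n+1)(\Delta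 a_n)E\Delta^{-1}\tfrac{hb_n}{ha_nb_n+1},$$ $$\bar T_{12}=h^{-1}(ha_nb_n+1)(\Delta a_n)E\Delta^{-1}\tfrac{ha_n}{ha_nb_n+1}+a_n\Delta^{-1}(\Delta a_n),$$ $$\bar T_{21}=h^{-1}(ha_nb_n+1)(E^{-1}\Delta b_n)\Delta^{-1}\tfrac{hb_n}{ha_nb_n+1}+b_nE\Delta^{-1}(E^{-1}\Delta b_n),$$ $$\bar T_{22}=h^{-1}(-ha_nb_nE^{-1}\Delta-E^{-1}\Delta+hb_nE\Delta^{-1}a_nE^{-1}\Delta)+h^{-1}(ha_nb_n+1)(E^{-1}\Delta b_n)\Delta^{-1}\tfrac{ha_n}{ha_nb_n+1}.$$ -/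

import Mathlib

open Filter Topology

namespace DDCLL

noncomputable section

/-- The backward difference `E⁻¹Δ`, that is `(E⁻¹Δ f) n = f n - f (n - 1)`. -/
def bwdDiff {R : Type*} [Ring R] (f : ℤ → R) : ℤ → R := fun n => f n - f (n - 1)

/-- The formal adjoint `Δ* = E⁻¹ - 1` of the difference operator `Δ = E - 1` with respect to the
pairing `∑ₙ fₙ gₙ`. -/
def adjDiff {R : Type*} [Ring R] (f : ℤ → R) : ℤ → R := fun n => f (n - 1) - f n

/-- A pseudo-difference operator `∑_{j ≤ m} pⱼ Δʲ` in the variable `n ∈ ℤ`, as a formal series: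
`coeff j` is the coefficient sequence `pⱼ`, and there are only finitely many positive powers. -/
@[ext]
structure PsdDiff (R : Type*) [CommRing R] where
  /-- The coefficient of `Δʲ`, a sequence over `ℤ`. -/
  coeff : ℤ → ℤ → R
  /-- The order is bounded above. -/
  bdd : ∃ m : ℤ, ∀ j, m < j → coeff j = 0

namespace PsdDiff

variable {R : Type*} [CommRing R]

/-- The identity operator. -/
def one : PsdDiff R where
  coeff j := if j = 0 then fun _ => 1 else 0
  bdd := ⟨0, fun j hj => if_neg (by omega)⟩

/-- The summand of `(P Q)ₖ(n)` that comes from `P_s Δˢ`, `Q_r Δʳ` with `r = k - s + i`, and from the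
`i`-th term of the Leibniz rule `Δˢ g = ∑ᵢ C(s, i) (Δⁱ g)(n + s - i) Δ^{s-i}`, `s ∈ ℤ`, where
`C(s, i) = s (s - 1) ⋯ (s - i + 1) / i!`. -/
def mulTerm (P Q : PsdDiff R) (k n : ℤ) (x : ℤ × ℕ) : R :=
  ((Ring.choose x.1 x.2 : ℤ) : R) * P.coeff x.1 n *
    ((fwdDiff (1 : ℤ))^[x.2] (Q.coeff (k - x.1 + x.2))) (n + x.1 - x.2)

theorem fwdDiff_iter_zero (i : ℕ) : ((fwdDiff (1 : ℤ))^[i] (0 : ℤ → R)) = 0 := by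
  induction i with
  | zero => rfl
  | succ i ih => rw [Function.iterate_succ_apply', ih]; funext n; simp [fwdDiff]

/-- Only finitely many terms contribute to each coefficient of a product. -/
theorem mulTerm_finite (P Q : PsdDiff R) (k n : ℤ) :
    (Function.support (mulTerm P Q k n)).Finite := by
  obtain ⟨m, hm⟩ := P.bdd
  obtain ⟨l, hl⟩ := Q.bdd
  refine ((Set.finite_Icc (k - l) m).prod (Set.finite_Iic (l - k + m).toNat)).subset ?_
  rintro ⟨s, i⟩ hx
  have h1 : s ≤ m := by
    by_contra! h
    exact hx (by simp [mulTerm, hm s h])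
  have h2 : k - s + i ≤ l := by
    by_contra! h
    exact hx (by simp [mulTerm, hl _ h, fwdDiff_iter_zero])
  simp only [Set.mem_prod, Set.mem_Icc, Set.mem_Iic]
  omega

/-- The composition of pseudo-difference operators, by the Leibniz rule. -/
def mul (P Q : PsdDiff R) : PsdDiff R where
  coeff k n := ∑ᶠ x : ℤ × ℕ, mulTerm P Q k n x
  bdd := by
    obtain ⟨m, hm⟩ := P.bdd
    obtain ⟨l, hl⟩ := Q.bdd
    refine ⟨m + l, fun k hk => ?_⟩
    funext n
    refine finsum_eq_zero_of_forall_eq_zero ?_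
    rintro ⟨s, i⟩
    by_cases h : m < s
    · simp [mulTerm, hm s h]
    · have h2 : l < k - s + i := by omega
      simp [mulTerm, hl _ h2, fwdDiff_iter_zero]

/-- Powers `Pˢ`. -/
def pow (P : PsdDiff R) : ℕ → PsdDiff R
  | 0 => one
  | s + 1 => mul P (pow P s)

/-- The pure difference part `(P)_{≥ 1}`. -/
def pos (P : PsdDiff R) : PsdDiff R where
  coeff j := if 1 ≤ j then P.coeff j else 0
  bdd := by
    obtain ⟨m, hm⟩ := P.bdd
    exact ⟨m, fun j hj => by simp [hm j hj]⟩

/-- The action `A g = ∑_{j ≥ 0} Aⱼ Δʲ g` of a difference operator `A` (one without negative powers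
of `Δ`) on a sequence; the sum is finite. -/
def act (A : PsdDiff R) (g : ℤ → R) : ℤ → R := fun n =>
  ∑ᶠ j : ℕ, A.coeff j n * ((fwdDiff (1 : ℤ))^[j] g) n

/-- The action `A* g = ∑_{j ≥ 0} (Δ*)ʲ (Aⱼ g)` of the adjoint of a difference operator `A` (one
without negative powers of `Δ`) on a sequence; the sum is finite. -/
def adjAct (A : PsdDiff R) (g : ℤ → R) : ℤ → R := fun n =>
  ∑ᶠ j : ℕ, (adjDiff^[j] (fun k => A.coeff j k * g k)) n

end PsdDiff

/-- The pseudo-difference Lax operator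
`L = h⁻¹ v Δ + v₀ + h v₁ Δ⁻¹ + h² v₂ Δ⁻² + ⋯` with `v = 1 + h ṽ`. -/
def lax {K : Type*} [Field K] (h : K) (vt : ℤ → K) (w : ℕ → ℤ → K) : PsdDiff K where
  coeff j n :=
    if j = 1 then h⁻¹ * (1 + h * vt n)
    else if j ≤ 0 then h ^ (-j).toNat * w (-j).toNat n
    else 0
  bdd := ⟨1, fun j hj => by
    funext n
    rw [if_neg (by omega), if_neg (by omega)]
    rfl⟩

/-- The difference operators `A_s = (Lˢ)_{≥ 1}`. -/
def laxA {K : Type*} [Field K] (h : K) (vt : ℤ → K) (w : ℕ → ℤ → K) (s : ℕ) : PsdDiff K :=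
  ((lax h vt w).pow s).pos

section Analysis

variable {𝕜 : Type*} [RCLike 𝕜]

/-- The inverse difference `(Δ⁻¹ f)ₙ = ∑_{k < n} fₖ`. -/
def dInv (f : ℤ → 𝕜) : ℤ → 𝕜 := fun n => ∑' k : ℕ, f (n - 1 - k)

/-- The times of the hierarchy are `t = (t₁, t₂, …)`; `HasPartial f c s t` says that `f` has the
partial derivative `c` in `t_s` at the point `t`. -/
def HasPartial (f : (ℕ+ → ℝ) → 𝕜) (c : 𝕜) (s : ℕ+) (t : ℕ+ → ℝ) : Prop :=
  HasDerivAt (fun τ : ℝ => f (Function.update t s τ)) c (t s)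

/-- The partial derivative of `f` in `t_s` at the point `t`. -/
def partialD (f : (ℕ+ → ℝ) → 𝕜) (s : ℕ+) (t : ℕ+ → ℝ) : 𝕜 :=
  deriv (fun τ : ℝ => f (Function.update t s τ)) (t s)

/-- A set of times that is open in each single coordinate direction. -/
def LineOpen (U : Set (ℕ+ → ℝ)) : Prop :=
  ∀ t ∈ U, ∀ s : ℕ+, ∀ᶠ τ in 𝓝 (t s), Function.update t s τ ∈ U

/-- Rapid decrease as `|n| → ∞`, locally uniformly along each time direction. -/
def RapidDecay (U : Set (ℕ+ → ℝ)) (f : ℤ → (ℕ+ → ℝ) → 𝕜) : Prop :=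
  ∀ t ∈ U, ∀ (s : ℕ+) (p : ℕ), ∃ C : ℝ, ∀ᶠ τ in 𝓝 (t s), ∀ n : ℤ,
    |(n : ℝ)| ^ p * ‖f n (Function.update t s τ)‖ ≤ C

/-- `T₁₁ u`, where
`T₁₁ = h⁻¹(h aₙ bₙ Δ + Δ + h aₙ Δ⁻¹ bₙ Δ) + h⁻¹(h aₙ bₙ + 1)(Δ aₙ) E Δ⁻¹ (h bₙ / (h aₙ bₙ + 1))`. -/
def T11 (h : 𝕜) (a b u : ℤ → 𝕜) : ℤ → 𝕜 := fun n =>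
  h⁻¹ * (h * a n * b n * fwdDiff 1 u n + fwdDiff 1 u n
      + h * a n * dInv (fun k => b k * fwdDiff 1 u k) n)
    + h⁻¹ * (h * a n * b n + 1) * fwdDiff 1 a n
      * dInv (fun k => h * b k / (h * a k * b k + 1) * u k) (n + 1)

/-- `T₁₂ w`, where
`T₁₂ = h⁻¹(h aₙ bₙ + 1)(Δ aₙ) E Δ⁻¹ (h aₙ / (h aₙ bₙ + 1)) + aₙ Δ⁻¹ (Δ aₙ)`. -/
def T12 (h : 𝕜) (a b w : ℤ → 𝕜) : ℤ → 𝕜 := fun n =>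
  h⁻¹ * (h * a n * b n + 1) * fwdDiff 1 a n
      * dInv (fun k => h * a k / (h * a k * b k + 1) * w k) (n + 1)
    + a n * dInv (fun k => fwdDiff 1 a k * w k) n

/-- `T₂₁ u`, where
`T₂₁ = h⁻¹(h aₙ bₙ + 1)(E⁻¹Δ bₙ) Δ⁻¹ (h bₙ / (h aₙ bₙ + 1)) + bₙ E Δ⁻¹ (E⁻¹Δ bₙ)`. -/
def T21 (h : 𝕜) (a b u : ℤ → 𝕜) : ℤ → 𝕜 := fun n =>
  h⁻¹ * (h * a n * b n + 1) * bwdDiff b n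
      * dInv (fun k => h * b k / (h * a k * b k + 1) * u k) n
    + b n * dInv (fun k => bwdDiff b k * u k) (n + 1)

/-- `T₂₂ w`, where
`T₂₂ = h⁻¹(-h aₙ bₙ E⁻¹Δ - E⁻¹Δ + h bₙ E Δ⁻¹ aₙ E⁻¹Δ)
  + h⁻¹(h aₙ bₙ + 1)(E⁻¹Δ bₙ) Δ⁻¹ (h aₙ / (h aₙ bₙ + 1))`. -/
def T22 (h : 𝕜) (a b w : ℤ → 𝕜) : ℤ → 𝕜 := fun n =>
  h⁻¹ * (-(h * a n * b n * bwdDiff w n) - bwdDiff w n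
      + h * b n * dInv (fun k => a k * bwdDiff w k) (n + 1))
    + h⁻¹ * (h * a n * b n + 1) * bwdDiff b n
      * dInv (fun k => h * a k / (h * a k * b k + 1) * w k) n

/-- All the sums `Δ⁻¹` that occur in `T (u, w)ᵀ` converge absolutely. -/
def TDefined (h : 𝕜) (a b u w : ℤ → 𝕜) : Prop :=
  Summable (fun k => b k * fwdDiff 1 u k) ∧
  Summable (fun k => h * b k / (h * a k * b k + 1) * u k) ∧
  Summable (fun k => h * a k / (h * a k * b k + 1) * w k) ∧
  Summable (fun k => fwdDiff 1 a k * w k) ∧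
  Summable (fun k => bwdDiff b k * u k) ∧
  Summable (fun k => a k * bwdDiff w k)

end Analysis

end

end DDCLL

/-!
The proof is a computation with one infinite matrix for each power of the Lax operator. A
pseudo-difference operator, expanded in descending powers of `E`, acts on sequences that vanish near
`-∞` through a kernel `K n m` that vanishes for `m > n + p`; the Leibniz product becomes the
composition of kernels (`PsdDiff.ker_mul`). The positive part `(P)_{≥ 1}` annihilates constants and
shares the entries above the diagonal with `P`, so it acts by
`f ↦ ∑_{m > n} K n m (f m - f n)` (`posAct`), and its adjoint applied to `β` is, up to sign, the
backward difference of the corner sums `∑_{k ≤ n < m} β k K k m` (`cornerSum`).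

The first flow needs the leading coefficient of `L` only. The Lax equation in `t₁` then determines
all further coefficients: `L = h⁻¹ (1 + h a b) Δ + a Δ⁻¹ b Δ` satisfies it, and the indeterminacy
`κ` of each coefficient solves `v n κ (n + 1) = κ n v (n - r)`, which has no nonzero solution that
tends to zero at `-∞` (`lax_eq_constrainedLax`, `eq_zero_of_mul_eq`).

Let `u = a_{t_s}` be the action of `(Lˢ)_{≥ 1}` on `a`, and let `w = b_{t_s}`. As `b` is an infinite
sum, its derivative is computed term by term with bounds uniform in time, and it telescopes to the
corner sum of the kernel of `Lˢ` with weights `β = E⁻¹Δ b` (`hasPartial_b`). With `c` the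
coefficient of `Δ⁰` in `Lˢ` and `v = 1 + h a b`, finite sums give
* from `Lˢ⁺¹ = L Lˢ`: `u' = h⁻¹ v (Δu + (Δa) E c) + a X` with `ΔX = b Δu + w Δa`
  (`posAct_kerMul_left`),
* from `Lˢ⁺¹ = Lˢ L`: `w' = h⁻¹ v (c β - E⁻¹Δ w) + b W` with `E⁻¹Δ W = β u + a E⁻¹Δ w`
  (`cornerSum_kerMul_right`),
* from `L Lˢ = Lˢ L`: `h⁻¹ v Δc = b u + a w` (`laxLead_mul_rowTail_sub`).
All of `X`, `W` and `c` tend to zero at `-∞`, so they are the sums `Δ⁻¹` that occur in `T`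
(`SliceBound.recursion`).
-/

namespace DDCLL

noncomputable section

/-! ### Kernels of pseudo-difference operators -/

section Kernels

variable {R : Type*} [CommRing R]

/-- The coefficient of `Eʳ` in the expansion of `Δʲ = (E - 1)ʲ`, `j ∈ ℤ`, in descending powers
of `E`. -/
def shiftCoeff (j r : ℤ) : ℤ :=
  if r ≤ j then (-1) ^ (j - r).toNat * Ring.choose j (j - r).toNat else 0

theorem shiftCoeff_of_lt {j r : ℤ} (hjr : j < r) : shiftCoeff j r = 0 :=
  if_neg (by omega)

theorem shiftCoeff_sub_natCast (j : ℤ) (i : ℕ) :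
    shiftCoeff j (j - i) = (-1) ^ i * Ring.choose j i := by
  rw [shiftCoeff, if_pos (by omega), show (j - (j - (i : ℤ))).toNat = i by omega]

/-- Vandermonde's identity: `Δˢ Δʳ = Δ^{s+r}` in terms of the expansions in `E`. -/
theorem sum_shiftCoeff_mul_shiftCoeff (s r n m : ℤ) {A B : ℤ} (hA : A ≤ m - r)
    (hB : n + s ≤ B) :
    ∑ l ∈ Finset.Icc A B, shiftCoeff s (l - n) * shiftCoeff r (m - l) =
      shiftCoeff (s + r) (m - n) := by
  rcases lt_or_ge (s + r) (m - n) with hlt | hge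
  · rw [shiftCoeff_of_lt hlt]
    refine Finset.sum_eq_zero fun l _ => ?_
    rcases lt_or_ge s (l - n) with h1 | h1
    · rw [shiftCoeff_of_lt h1, zero_mul]
    · rw [shiftCoeff_of_lt (show r < m - l by omega), mul_zero]
  obtain ⟨d, hd⟩ : ∃ d : ℕ, m - n = s + r - d := ⟨(s + r - (m - n)).toNat, by omega⟩
  rw [hd, shiftCoeff_sub_natCast, Ring.add_choose_eq d (Commute.all s r), Finset.mul_sum,
    Finset.Nat.sum_antidiagonal_eq_sum_range_succ
      (fun i j => (-1 : ℤ) ^ d * (Ring.choose s i * Ring.choose r j))]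
  symm
  refine Finset.sum_of_injOn (fun i : ℕ => n + s - (i : ℤ)) ?_ ?_ ?_ ?_
  · intro i _ j _ hij
    simpa using hij
  · intro i hi
    simp only [Finset.coe_range, Set.mem_Iio, Finset.coe_Icc, Set.mem_Icc] at hi ⊢
    omega
  · intro l _ hl2
    rcases lt_or_ge s (l - n) with h1 | h1
    · rw [shiftCoeff_of_lt h1, zero_mul]
    · rw [shiftCoeff_of_lt (j := r), mul_zero]
      by_contra! hcon
      exact hl2 ⟨(s - (l - n)).toNat, by simp; omega, by simp; omega⟩
  · intro i hi
    have hi' : i ≤ d := by simpa [Nat.lt_succ_iff] using hi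
    rw [show n + s - (i : ℤ) - n = s - (i : ℤ) by ring, shiftCoeff_sub_natCast,
      show m - (n + s - (i : ℤ)) = r - ((d - i : ℕ) : ℤ) by omega,
      shiftCoeff_sub_natCast]
    rw [show (-1 : ℤ) ^ d = (-1) ^ i * (-1) ^ (d - i) by rw [← pow_add]; congr 1; omega]
    ring

open fwdDiff_aux in
/-- The expansion of `(-1)ʳ = (Δ - E)ʳ` by the binomial theorem. -/
theorem sum_choose_mul_fwdDiff_shift (Q : ℤ → R) (r : ℕ) (y : ℤ) :
    ∑ i ∈ Finset.range (r + 1), ((-1 : R) ^ (r - i) * (r.choose i : R)) *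
      ((fwdDiff (1 : ℤ))^[i] Q) (y + (r - i : ℕ)) = (-1) ^ r * Q y := by
  have hcomm : Commute (fwdDiffₗ ℤ R 1) (-shiftₗ ℤ R 1) := by
    refine Commute.neg_right ?_
    exact (Commute.refl _).add_right (Commute.one_right _)
  have key := hcomm.add_pow r
  have hsum : fwdDiffₗ ℤ R 1 + -shiftₗ ℤ R 1 = -1 := by
    simp [shiftₗ]
  rw [hsum] at key
  have key2 := congrFun (congrArg (fun F : Module.End ℤ (ℤ → R) => F Q) key) y
  have hneg : (((-1 : Module.End ℤ (ℤ → R)) ^ r) Q) y = (-1) ^ r * Q y := by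
    rcases Nat.even_or_odd r with hr | hr <;> simp [hr.neg_one_pow]
  rw [hneg] at key2
  rw [key2, LinearMap.sum_apply, Finset.sum_apply]
  refine Finset.sum_congr rfl fun i _ => ?_
  have hnat (c : ℕ) (F : Module.End ℤ (ℤ → R)) (f : ℤ → R) :
      (F * (c : Module.End ℤ (ℤ → R))) f = c • F f := by
    rw [Module.End.mul_apply, Module.End.natCast_apply, map_nsmul]
  have hpow (c : ℕ) (f : ℤ → R) (y : ℤ) :
      ((-shiftₗ ℤ R 1) ^ c) f y = (-1) ^ c * f (y + c) := by
    have hshift := shiftₗ_pow_apply (1 : ℤ) f c y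
    rcases Nat.even_or_odd c with hc | hc
    · simp [hc.neg_pow, hshift]
    · simp [hc.neg_pow, hshift]
  rw [hnat, (hcomm.pow_pow i (r - i)).eq, Module.End.mul_apply, Pi.smul_apply, hpow,
    coe_fwdDiffₗ_pow, nsmul_eq_mul]
  ring

/-- The Leibniz rule `Δˢ Q = ∑ᵢ C(s, i) (Δⁱ Q)(n + s - i) Δ^{s-i}`, compared at `Eˣ`. -/
theorem shiftCoeff_leibniz (Q : ℤ → R) (s x n : ℤ) {I : ℕ} (hI : s - x < I) :
    (shiftCoeff s x : R) * Q (n + x) = ∑ i ∈ Finset.range I,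
      ((Ring.choose s i : ℤ) : R) * ((fwdDiff (1 : ℤ))^[i] Q) (n + s - i) *
        (shiftCoeff (s - i) x : R) := by
  rcases lt_or_ge s x with hlt | hge
  · rw [shiftCoeff_of_lt hlt, Finset.sum_eq_zero]
    · simp
    · intro i _
      rw [shiftCoeff_of_lt (show s - (i : ℤ) < x by omega)]
      simp
  obtain ⟨r, hr⟩ : ∃ r : ℕ, x = s - r := ⟨(s - x).toNat, by omega⟩
  subst hr
  have hsub : Finset.range (r + 1) ⊆ Finset.range I := by
    intro i hi
    simp only [Finset.mem_range] at hi ⊢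
    omega
  rw [← Finset.sum_subset hsub, shiftCoeff_sub_natCast]
  · push_cast
    rw [mul_right_comm, ← sum_choose_mul_fwdDiff_shift Q r (n + (s - r)), Finset.sum_mul]
    refine Finset.sum_congr rfl fun i hi => ?_
    have hi' : i ≤ r := by simpa [Nat.lt_succ_iff] using hi
    rw [show n + (s - (r : ℤ)) + ((r - i : ℕ) : ℤ) = n + s - i by omega,
      show s - (r : ℤ) = s - i - ((r - i : ℕ) : ℤ) by omega, shiftCoeff_sub_natCast]
    -- `C(r, i) C(s, r) = C(s, i) C(s - i, r - i)` reduces the sum to the expansion of `(Δ - E)ʳ`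
    have hch := Ring.choose_smul_choose (s : ℤ) hi'
    have hch' : (r.choose i : R) * ((Ring.choose s r : ℤ) : R) =
        ((Ring.choose s i : ℤ) : R) * ((Ring.choose (s - i) (r - i) : ℤ) : R) := by
      have := congrArg (Int.cast : ℤ → R) hch
      push_cast [nsmul_eq_mul] at this
      exact this
    push_cast
    linear_combination ((-1 : R) ^ (r - i) * ((fwdDiff (1 : ℤ))^[i] Q) (n + s - i)) * hch'
  · intro i _ hi
    rw [shiftCoeff_of_lt, Int.cast_zero, mul_zero]
    simp only [Finset.mem_range] at hi
    omega

/-- The kernel of a pseudo-difference operator: `P` acts on sequences that vanish near `-∞` by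
`(P f) n = ∑ₘ ker P n m * f m`. -/
def PsdDiff.ker (P : PsdDiff R) (n m : ℤ) : R :=
  ∑ᶠ j : ℤ, P.coeff j n * (shiftCoeff j (m - n) : R)

theorem PsdDiff.ker_eq_sum (P : PsdDiff R) {p A B : ℤ} (hP : ∀ j, p < j → P.coeff j = 0)
    (n m : ℤ) (hA : A ≤ m - n) (hB : p ≤ B) :
    P.ker n m = ∑ j ∈ Finset.Icc A B, P.coeff j n * (shiftCoeff j (m - n) : R) := by
  refine finsum_eq_sum_of_support_subset _ fun j hj => ?_
  simp only [Finset.coe_Icc, Set.mem_Icc]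
  constructor
  · by_contra! hlt
    exact hj (by simp [shiftCoeff_of_lt (show j < m - n by omega)])
  · by_contra! hlt
    exact hj (by simp [hP j (by omega)])

/-- The kernel `K n m` vanishes for `m > n + p`, as that of an operator of order `p` does. -/
def Banded (p : ℤ) (K : ℤ → ℤ → R) : Prop :=
  ∀ n m, n + p < m → K n m = 0

theorem PsdDiff.banded_ker {P : PsdDiff R} {p : ℤ} (hP : ∀ j, p < j → P.coeff j = 0) :
    Banded p P.ker := by
  intro n m hnm
  rw [P.ker_eq_sum hP n m le_rfl le_rfl, Finset.Icc_eq_empty (by omega), Finset.sum_empty]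

/-- The composition of kernels. -/
def kerMul (K M : ℤ → ℤ → R) (n m : ℤ) : R :=
  ∑ᶠ k : ℤ, K n k * M k m

theorem kerMul_eq_sum {K M : ℤ → ℤ → R} {p q A B : ℤ} (hK : Banded p K) (hM : Banded q M)
    (n m : ℤ) (hA : A ≤ m - q) (hB : n + p ≤ B) :
    kerMul K M n m = ∑ k ∈ Finset.Icc A B, K n k * M k m := by
  refine finsum_eq_sum_of_support_subset _ fun k hk => ?_
  simp only [Finset.coe_Icc, Set.mem_Icc]
  constructor
  · by_contra! hlt
    exact hk (by simp [hM k m (by omega)])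
  · by_contra! hlt
    exact hk (by simp [hK n k (by omega)])

theorem Banded.kerMul {K M : ℤ → ℤ → R} {p q : ℤ} (hK : Banded p K) (hM : Banded q M) :
    Banded (p + q) (kerMul K M) := by
  intro n m hnm
  rw [kerMul_eq_sum hK hM n m le_rfl le_rfl, Finset.Icc_eq_empty (by omega), Finset.sum_empty]

theorem kerMul_assoc {K M N : ℤ → ℤ → R} {p q r : ℤ} (hK : Banded p K) (hM : Banded q M)
    (hN : Banded r N) : kerMul (kerMul K M) N = kerMul K (kerMul M N) := by
  funext n m
  rw [kerMul_eq_sum (hK.kerMul hM) hN n m le_rfl le_rfl,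
    kerMul_eq_sum hK (hM.kerMul hN) n m le_rfl le_rfl]
  have h1 : ∀ k ∈ Finset.Icc (m - r) (n + (p + q)), DDCLL.kerMul K M n k * N k m =
      ∑ j ∈ Finset.Icc (m - (q + r)) (n + p), K n j * M j k * N k m := by
    intro k hk
    rw [Finset.mem_Icc] at hk
    rw [kerMul_eq_sum hK hM n k (show m - (q + r) ≤ k - q by omega) le_rfl, Finset.sum_mul]
  have h2 : ∀ j ∈ Finset.Icc (m - (q + r)) (n + p), K n j * DDCLL.kerMul M N j m =
      ∑ k ∈ Finset.Icc (m - r) (n + (p + q)), K n j * M j k * N k m := by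
    intro j hj
    rw [Finset.mem_Icc] at hj
    rw [kerMul_eq_sum hM hN j m le_rfl (show j + q ≤ n + (p + q) by omega), Finset.mul_sum]
    simp only [mul_assoc]
  rw [Finset.sum_congr rfl h1, Finset.sum_congr rfl h2, Finset.sum_comm]

theorem PsdDiff.mul_coeff_eq_sum (P Q : PsdDiff R) {p q A B : ℤ}
    (hP : ∀ j, p < j → P.coeff j = 0) (hQ : ∀ j, q < j → Q.coeff j = 0) (k n : ℤ) {I : ℕ}
    (hA : A ≤ k - q) (hB : p ≤ B) (hI : p + q - k < I) :
    (P.mul Q).coeff k n =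
      ∑ s ∈ Finset.Icc A B, ∑ i ∈ Finset.range I, P.mulTerm Q k n (s, i) := by
  rw [← Finset.sum_product']
  refine finsum_eq_sum_of_support_subset _ ?_
  rintro ⟨s, i⟩ hx
  have h1 : s ≤ p := by
    by_contra! hlt
    exact hx (by simp [PsdDiff.mulTerm, hP s hlt])
  have h2 : k - s + i ≤ q := by
    by_contra! hlt
    exact hx (by simp [PsdDiff.mulTerm, hQ _ hlt, PsdDiff.fwdDiff_iter_zero])
  simp only [Finset.coe_product, Finset.coe_Icc, Finset.coe_range, Set.mem_prod, Set.mem_Icc,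
    Set.mem_Iio]
  omega

theorem PsdDiff.mul_coeff_of_lt {P Q : PsdDiff R} {p q : ℤ} (hP : ∀ j, p < j → P.coeff j = 0)
    (hQ : ∀ j, q < j → Q.coeff j = 0) (j : ℤ) (hj : p + q < j) : (P.mul Q).coeff j = 0 := by
  funext n
  rw [P.mul_coeff_eq_sum Q hP hQ j n le_rfl le_rfl (I := 0) (by omega)]
  simp

/-- The kernel turns the Leibniz product into the composition of kernels. -/
theorem PsdDiff.ker_mul (P Q : PsdDiff R) : (P.mul Q).ker = kerMul P.ker Q.ker := by
  obtain ⟨p, hP⟩ := P.bdd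
  obtain ⟨q, hQ⟩ := Q.bdd
  funext n m
  set I : ℕ := (p + q - (m - n)).toNat + 1 with hI
  have hIlt : p + q - (m - n) < I := by omega
  set S := Finset.Icc (m - n - q) p
  -- both sides are reduced to the sum of `F s i r` over `s`, `i` and `r`
  set F : ℤ → ℕ → ℤ → R := fun s i r =>
    ((Ring.choose s i : ℤ) : R) * P.coeff s n *
      ((fwdDiff (1 : ℤ))^[i] (Q.coeff r)) (n + s - i) * (shiftCoeff (s - i + r) (m - n) : R)
    with hF
  have hleft : (P.mul Q).ker n m =
      ∑ s ∈ S, ∑ i ∈ Finset.range I, ∑ k ∈ Finset.Icc (m - n) (p + q), F s i (k - s + i) := by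
    rw [(P.mul Q).ker_eq_sum (PsdDiff.mul_coeff_of_lt hP hQ) n m le_rfl le_rfl]
    have h1 : ∀ k ∈ Finset.Icc (m - n) (p + q),
        (P.mul Q).coeff k n * (shiftCoeff k (m - n) : R) =
          ∑ s ∈ S, ∑ i ∈ Finset.range I, F s i (k - s + i) := by
      intro k hk
      rw [Finset.mem_Icc] at hk
      rw [P.mul_coeff_eq_sum Q hP hQ k n (show m - n - q ≤ k - q by omega) le_rfl
        (show p + q - k < I by omega), Finset.sum_mul]
      refine Finset.sum_congr rfl fun s _ => ?_
      rw [Finset.sum_mul]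
      refine Finset.sum_congr rfl fun i _ => ?_
      simp only [hF, PsdDiff.mulTerm]
      rw [show s - (i : ℤ) + (k - s + i) = k by ring]
    rw [Finset.sum_congr rfl h1, Finset.sum_comm]
    exact Finset.sum_congr rfl fun s _ => Finset.sum_comm
  have hright : kerMul P.ker Q.ker n m =
      ∑ s ∈ S, ∑ i ∈ Finset.range I, ∑ r ∈ Finset.Icc (m - n - p) q, F s i r := by
    rw [kerMul_eq_sum (PsdDiff.banded_ker hP) (PsdDiff.banded_ker hQ) n m le_rfl le_rfl]
    have h1 : ∀ l ∈ Finset.Icc (m - q) (n + p), P.ker n l * Q.ker l m =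
        ∑ s ∈ S, ∑ r ∈ Finset.Icc (m - n - p) q, ∑ i ∈ Finset.range I,
          ((Ring.choose s i : ℤ) : R) * P.coeff s n *
          ((fwdDiff (1 : ℤ))^[i] (Q.coeff r)) (n + s - i) *
          ((shiftCoeff (s - i) (l - n) : R) * (shiftCoeff r (m - l) : R)) := by
      intro l hl
      rw [Finset.mem_Icc] at hl
      rw [P.ker_eq_sum hP n l (show m - n - q ≤ l - n by omega) le_rfl,
        Q.ker_eq_sum hQ l m (show m - n - p ≤ m - l by omega) le_rfl, Finset.sum_mul_sum]
      refine Finset.sum_congr rfl fun s hs => Finset.sum_congr rfl fun r _ => ?_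
      rw [Finset.mem_Icc] at hs
      have hL := shiftCoeff_leibniz (Q.coeff r) s (l - n) n (show s - (l - n) < I by omega)
      rw [show n + (l - n) = l by ring] at hL
      rw [show P.coeff s n * (shiftCoeff s (l - n) : R) *
          (Q.coeff r l * (shiftCoeff r (m - l) : R)) =
          P.coeff s n * ((shiftCoeff s (l - n) : R) * Q.coeff r l) *
            (shiftCoeff r (m - l) : R) by ring, hL, Finset.mul_sum, Finset.sum_mul]
      exact Finset.sum_congr rfl fun i _ => by ring
    rw [Finset.sum_congr rfl h1, Finset.sum_comm]
    refine Finset.sum_congr rfl fun s hs => ?_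
    rw [Finset.mem_Icc] at hs
    rw [Finset.sum_comm, Finset.sum_comm (s := Finset.range I)]
    refine Finset.sum_congr rfl fun r hr => ?_
    rw [Finset.mem_Icc] at hr
    rw [Finset.sum_comm]
    refine Finset.sum_congr rfl fun i _ => ?_
    rw [← Finset.mul_sum]
    have hV := congrArg (Int.cast : ℤ → R) (sum_shiftCoeff_mul_shiftCoeff (s - i) r n m
      (show m - q ≤ m - r by omega) (show n + (s - i) ≤ n + p by omega))
    push_cast at hV
    rw [hV]
  rw [hleft, hright]
  refine Finset.sum_congr rfl fun s hs => Finset.sum_congr rfl fun i _ => ?_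
  rw [Finset.mem_Icc] at hs
  have hsupp : ∀ r, F s i r ≠ 0 → m - n ≤ s - i + r ∧ r ≤ q := by
    intro r hr
    constructor
    · by_contra! hlt
      exact hr (by simp [hF, shiftCoeff_of_lt hlt])
    · by_contra! hlt
      exact hr (by simp [hF, hQ r hlt, PsdDiff.fwdDiff_iter_zero])
  rw [← finsum_eq_sum_of_support_subset (fun k => F s i (k - s + i)) (fun k hk => ?_),
    ← finsum_eq_sum_of_support_subset (F s i) (fun r hr => ?_)]
  · exact finsum_comp_equiv (f := F s i) ((Equiv.subRight s).trans (Equiv.addRight (i : ℤ)))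
  · have := hsupp r hr
    simp only [Finset.coe_Icc, Set.mem_Icc]
    omega
  · have := hsupp _ hk
    simp only [Finset.coe_Icc, Set.mem_Icc]
    omega

end Kernels

/-! ### Half-line sums and the action of positive parts -/

section HalfLineSums

variable {R : Type*} [CommRing R]

/-- The sum `∑_{m > n} f m` of a sequence that vanishes near `+∞`. -/
def upSum (f : ℤ → R) (n : ℤ) : R := ∑ᶠ m, if n < m then f m else 0

/-- The sum `∑_{m ≤ n} f m` of a sequence that vanishes near `-∞`. -/
def downSum (f : ℤ → R) (n : ℤ) : R := ∑ᶠ m, if m ≤ n then f m else 0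

theorem upSum_eq_sum {f : ℤ → R} {N : ℤ} (n : ℤ) (hf : ∀ m, n < m → N < m → f m = 0) :
    upSum f n = ∑ m ∈ Finset.Ioc n N, f m := by
  rw [upSum, finsum_eq_sum_of_support_subset (s := Finset.Ioc n N)]
  · refine Finset.sum_congr rfl fun m hm => if_pos (Finset.mem_Ioc.1 hm).1
  · intro m hm
    rw [Finset.coe_Ioc, Set.mem_Ioc]
    by_cases h1 : n < m
    · refine ⟨h1, ?_⟩
      by_contra! h2
      exact hm (by simp [hf m h1 h2])
    · exact absurd (by simp [h1]) hm

theorem downSum_eq_sum {f : ℤ → R} {N : ℤ} (n : ℤ) (hf : ∀ m, m ≤ n → m ≤ N → f m = 0) :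
    downSum f n = ∑ m ∈ Finset.Ioc N n, f m := by
  rw [downSum, finsum_eq_sum_of_support_subset (s := Finset.Ioc N n)]
  · refine Finset.sum_congr rfl fun m hm => if_pos (Finset.mem_Ioc.1 hm).2
  · intro m hm
    rw [Finset.coe_Ioc, Set.mem_Ioc]
    by_cases h1 : m ≤ n
    · refine ⟨?_, h1⟩
      by_contra! h2
      exact hm (by simp [hf m h1 h2])
    · exact absurd (by simp [h1]) hm

theorem upSum_sub_one {f : ℤ → R} {N : ℤ} (hf : ∀ m, N < m → f m = 0) (n : ℤ) :
    upSum f (n - 1) = f n + upSum f n := by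
  have hf' : ∀ m, max N n < m → f m = 0 := fun m hm => hf m (lt_of_le_of_lt (le_max_left _ _) hm)
  rw [upSum_eq_sum (n - 1) fun m _ => hf' m, upSum_eq_sum n fun m _ => hf' m,
    ← Finset.sum_insert (by simp)]
  congr 1
  ext m
  simp only [Finset.mem_Ioc, Finset.mem_insert]
  have := le_max_right N n
  omega

theorem downSum_sub_one {f : ℤ → R} {N : ℤ} (hf : ∀ m, m ≤ N → f m = 0) (n : ℤ) :
    downSum f n = f n + downSum f (n - 1) := by
  have hf' : ∀ m, m ≤ min N (n - 1) → f m = 0 := fun m hm => hf m (hm.trans (min_le_left _ _))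
  rw [downSum_eq_sum n fun m _ => hf' m, downSum_eq_sum (n - 1) fun m _ => hf' m,
    ← Finset.sum_insert (by simp)]
  congr 1
  ext m
  simp only [Finset.mem_Ioc, Finset.mem_insert]
  have := min_le_right N (n - 1)
  omega

theorem downSum_add {f g : ℤ → R} {N : ℤ} (hf : ∀ m, m ≤ N → f m = 0)
    (hg : ∀ m, m ≤ N → g m = 0) (n : ℤ) :
    downSum (fun m => f m + g m) n = downSum f n + downSum g n := by
  rw [downSum_eq_sum n fun m _ => hf m, downSum_eq_sum n fun m _ => hg m,
    downSum_eq_sum (N := N) n fun m _ hm => by rw [hf m hm, hg m hm, add_zero],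
    Finset.sum_add_distrib]

theorem downSum_const_mul {f : ℤ → R} {N : ℤ} (hf : ∀ m, m ≤ N → f m = 0) (c : R) (n : ℤ) :
    downSum (fun m => c * f m) n = c * downSum f n := by
  rw [downSum_eq_sum n fun m _ => hf m,
    downSum_eq_sum (N := N) n fun m _ hm => by rw [hf m hm, mul_zero], Finset.mul_sum]

theorem downSum_eq_zero {f : ℤ → R} {n : ℤ} (hf : ∀ m, m ≤ n → f m = 0) : downSum f n = 0 := by
  rw [downSum_eq_sum (N := n) n fun m _ hm => hf m hm]
  simp

theorem upSum_eq_zero {f : ℤ → R} {n : ℤ} (hf : ∀ m, n < m → f m = 0) : upSum f n = 0 := by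
  rw [upSum_eq_sum (N := n) n fun m _ => hf m]
  simp

/-- A sequence is recovered from its differences if it vanishes near `+∞`. -/
theorem eq_upSum {f X : ℤ → R} {N : ℤ} (hf : ∀ m, N < m → f m = 0)
    (hX : ∀ n, X (n - 1) = f n + X n) (hX0 : ∀ n, N ≤ n → X n = 0) (n : ℤ) :
    X n = upSum f n := by
  have key : ∀ d : ℕ, X (N - d) = upSum f (N - d) := by
    intro d
    induction d with
    | zero =>
      rw [hX0 _ (by simp), upSum_eq_zero fun m hm => hf m (by simpa using hm)]
    | succ d ih =>
      rw [show N - ((d + 1 : ℕ) : ℤ) = N - d - 1 by push_cast; ring, hX, upSum_sub_one hf, ih]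
  rcases le_total N n with h | h
  · rw [hX0 n h, upSum_eq_zero fun m hm => hf m (by omega)]
  · have := key (N - n).toNat
    rwa [show N - ((N - n).toNat : ℤ) = n by omega] at this

end HalfLineSums

section Action

variable {R : Type*} [CommRing R]

theorem shiftCoeff_natCast {j i : ℕ} (hij : i ≤ j) :
    shiftCoeff j i = (-1) ^ (j - i) * (j.choose i : ℤ) := by
  rw [show (i : ℤ) = j - ((j - i : ℕ) : ℤ) by omega, shiftCoeff_sub_natCast,
    show Ring.choose (j : ℤ) (j - i) = _ from Ring.choose_natCast j (j - i), Nat.choose_symm hij]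

theorem fwdDiff_one_iter_eq_sum (f : ℤ → R) (j : ℕ) (n : ℤ) {B : ℤ} (hB : n + j ≤ B) :
    ((fwdDiff (1 : ℤ))^[j] f) n =
      ∑ m ∈ Finset.Icc n B, (shiftCoeff j (m - n) : R) * f m := by
  rw [fwdDiff_iter_eq_sum_shift]
  refine Finset.sum_of_injOn (fun i : ℕ => n + (i : ℤ)) ?_ ?_ ?_ ?_
  · intro i _ k _ hik
    simpa using hik
  · intro i hi
    simp only [Finset.coe_range, Set.mem_Iio, Finset.coe_Icc, Set.mem_Icc] at hi ⊢
    omega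
  · intro m hm hm2
    rw [Finset.mem_Icc] at hm
    rw [shiftCoeff_of_lt, Int.cast_zero, zero_mul]
    by_contra! hcon
    exact hm2 ⟨(m - n).toNat, by simp; omega, by simp; omega⟩
  · intro i hi
    have hi' : i ≤ j := by simpa [Nat.lt_succ_iff] using hi
    rw [add_sub_cancel_left, shiftCoeff_natCast hi', zsmul_eq_mul]
    simp

theorem adjDiff_iter_eq_sum (f : ℤ → R) (j : ℕ) (n : ℤ) {A : ℤ} (hA : A ≤ n - j) :
    (adjDiff^[j] f) n = ∑ m ∈ Finset.Icc A n, (shiftCoeff j (n - m) : R) * f m := by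
  rw [show (adjDiff : (ℤ → R) → ℤ → R) = fwdDiff (-1 : ℤ) from rfl, fwdDiff_iter_eq_sum_shift]
  refine Finset.sum_of_injOn (fun i : ℕ => n - (i : ℤ)) ?_ ?_ ?_ ?_
  · intro i _ k _ hik
    simpa using hik
  · intro i hi
    simp only [Finset.coe_range, Set.mem_Iio, Finset.coe_Icc, Set.mem_Icc] at hi ⊢
    omega
  · intro m hm hm2
    rw [Finset.mem_Icc] at hm
    rw [shiftCoeff_of_lt, Int.cast_zero, zero_mul]
    by_contra! hcon
    exact hm2 ⟨(n - m).toNat, by simp; omega, by simp; omega⟩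
  · intro i hi
    have hi' : i ≤ j := by simpa [Nat.lt_succ_iff] using hi
    rw [sub_sub_cancel, shiftCoeff_natCast hi', zsmul_eq_mul, smul_neg, nsmul_one,
      ← sub_eq_add_neg]

/-- `Δʲ 1 = 0` for `j ≥ 1`. -/
theorem sum_shiftCoeff_eq_zero {j : ℕ} (hj : 1 ≤ j) (n : ℤ) {B : ℤ} (hB : n + j ≤ B) :
    ∑ m ∈ Finset.Icc n B, (shiftCoeff j (m - n) : R) = 0 := by
  have := fwdDiff_one_iter_eq_sum (fun _ => (1 : R)) j n hB
  simp only [mul_one] at this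
  rw [← this]
  obtain ⟨i, rfl⟩ := Nat.exists_eq_succ_of_ne_zero (Nat.one_le_iff_ne_zero.1 hj)
  rw [Function.iterate_succ_apply, fwdDiff_const,
    show (fun _ : ℤ => (0 : R)) = 0 from rfl, PsdDiff.fwdDiff_iter_zero, Pi.zero_apply]

/-- Above the diagonal, the kernel involves the positive powers of `Δ` only. -/
theorem PsdDiff.ker_eq_sum_range (P : PsdDiff R) {N : ℕ} (hP : ∀ j, (N : ℤ) < j → P.coeff j = 0)
    {n m : ℤ} (hnm : n < m) :
    P.ker n m =
      ∑ j ∈ Finset.range (N + 1), P.pos.coeff j n * (shiftCoeff j (m - n) : R) := by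
  rw [P.ker_eq_sum hP n m (show 1 ≤ m - n by omega) le_rfl]
  symm
  have h0 : P.pos.coeff 0 = 0 := by simp [PsdDiff.pos]
  rw [Finset.sum_range_succ', Nat.cast_zero, h0, Pi.zero_apply, zero_mul, add_zero]
  refine Finset.sum_of_injOn (fun j : ℕ => ((j + 1 : ℕ) : ℤ)) ?_ ?_ ?_ ?_
  · intro i _ k _ hik
    simpa using hik
  · intro j hj
    simp only [Finset.coe_range, Set.mem_Iio, Finset.coe_Icc, Set.mem_Icc] at hj ⊢
    omega
  · intro j hj hj2
    rw [Finset.mem_Icc] at hj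
    exact absurd ⟨(j - 1).toNat, by simp; omega, by simp; omega⟩ hj2
  · intro j _
    have hj : (1 : ℤ) ≤ ((j + 1 : ℕ) : ℤ) := by omega
    simp only [PsdDiff.pos, if_pos hj]

theorem PsdDiff.pos_coeff_eq_zero {P : PsdDiff R} {N : ℤ} (hP : ∀ j, N < j → P.coeff j = 0)
    {j : ℤ} (hj : N < j) : P.pos.coeff j = 0 := by
  simp [PsdDiff.pos, hP j hj]

/-- The action of the positive part of `P` in terms of the kernel of `P`: only the entries above
the diagonal enter, and the diagonal of the kernel of `P_{≥ 1}` is fixed by `P_{≥ 1} 1 = 0`. -/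
theorem PsdDiff.act_pos (P : PsdDiff R) (f : ℤ → R) (n : ℤ) :
    P.pos.act f n = upSum (fun m => P.ker n m * (f m - f n)) n := by
  obtain ⟨p, hp⟩ := P.bdd
  obtain ⟨N, hpN⟩ : ∃ N : ℕ, p ≤ N := ⟨p.toNat, by omega⟩
  have hP : ∀ j, (N : ℤ) < j → P.coeff j = 0 := fun j hj => hp j (by omega)
  rw [upSum_eq_sum (N := n + N) n fun m _ hm => by rw [banded_ker hP n m hm, zero_mul]]
  have h1 : P.pos.act f n = ∑ j ∈ Finset.range (N + 1),
      P.pos.coeff j n * ((fwdDiff (1 : ℤ))^[j] f) n := by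
    refine finsum_eq_sum_of_support_subset _ fun j hj => ?_
    rw [Finset.coe_range, Set.mem_Iio]
    by_contra! hlt
    exact hj (by simp [pos_coeff_eq_zero hP (show (N : ℤ) < j by omega)])
  have h2 : ∀ j ∈ Finset.range (N + 1), P.pos.coeff j n * ((fwdDiff (1 : ℤ))^[j] f) n =
      ∑ m ∈ Finset.Ioc n (n + N),
        P.pos.coeff j n * (shiftCoeff j (m - n) : R) * (f m - f n) := by
    intro j hj
    have hj' : j ≤ N := by simpa [Nat.lt_succ_iff] using hj
    rcases Nat.eq_zero_or_pos j with rfl | hpos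
    · simp [PsdDiff.pos]
    have hd : ((fwdDiff (1 : ℤ))^[j] f) n =
        ∑ m ∈ Finset.Icc n (n + N), (shiftCoeff j (m - n) : R) * (f m - f n) := by
      simp only [mul_sub]
      rw [Finset.sum_sub_distrib, ← Finset.sum_mul,
        sum_shiftCoeff_eq_zero hpos n (by omega), zero_mul, sub_zero,
        fwdDiff_one_iter_eq_sum f j n (show n + j ≤ n + N by omega)]
    rw [hd, ← Finset.add_sum_Ioc_eq_sum_Icc (by omega), sub_self (f n), mul_zero, zero_add,
      Finset.mul_sum]
    exact Finset.sum_congr rfl fun m _ => by ring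
  rw [h1, Finset.sum_congr rfl h2, Finset.sum_comm]
  refine Finset.sum_congr rfl fun m hm => ?_
  rw [P.ker_eq_sum_range hP (Finset.mem_Ioc.1 hm).1, Finset.sum_mul]

/-- The action of the adjoint of the positive part of `P` in terms of the kernel of `P`. -/
theorem PsdDiff.adjAct_pos (P : PsdDiff R) (g : ℤ → R) (n : ℤ) :
    P.pos.adjAct g n =
      downSum (fun k => g k * P.ker k n) (n - 1) - g n * upSum (P.ker n) n := by
  obtain ⟨p, hp⟩ := P.bdd
  obtain ⟨N, hpN⟩ : ∃ N : ℕ, p ≤ N := ⟨p.toNat, by omega⟩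
  have hP : ∀ j, (N : ℤ) < j → P.coeff j = 0 := fun j hj => hp j (by omega)
  rw [upSum_eq_sum (N := n + N) n fun m _ hm => banded_ker hP n m hm,
    downSum_eq_sum (N := n - N - 1) (n - 1) fun k _ hk => by
      rw [banded_ker hP k n (by omega), mul_zero]]
  have h1 : P.pos.adjAct g n = ∑ j ∈ Finset.range (N + 1),
      (adjDiff^[j] (fun k => P.pos.coeff j k * g k)) n := by
    refine finsum_eq_sum_of_support_subset _ fun j hj => ?_
    rw [Finset.coe_range, Set.mem_Iio]
    by_contra! hlt
    refine hj ?_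
    refine (adjDiff_iter_eq_sum _ j n le_rfl).trans ?_
    refine Finset.sum_eq_zero fun m _ => ?_
    simp [pos_coeff_eq_zero hP (show (N : ℤ) < j by omega)]
  have h2 : ∀ j ∈ Finset.range (N + 1), (adjDiff^[j] (fun k => P.pos.coeff j k * g k)) n =
      (∑ k ∈ Finset.Ioc (n - N - 1) (n - 1),
        g k * (P.pos.coeff j k * (shiftCoeff j (n - k) : R))) -
      g n * ∑ m ∈ Finset.Ioc n (n + N), P.pos.coeff j n * (shiftCoeff j (m - n) : R) := by
    intro j hj
    have hj' : j ≤ N := by simpa [Nat.lt_succ_iff] using hj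
    rcases Nat.eq_zero_or_pos j with rfl | hpos
    · simp [PsdDiff.pos]
    have hd : (shiftCoeff j (n - n) : R) =
        -∑ m ∈ Finset.Ioc n (n + N), (shiftCoeff j (m - n) : R) := by
      rw [eq_neg_iff_add_eq_zero, Finset.add_sum_Ioc_eq_sum_Icc
        (f := fun m => (shiftCoeff j (m - n) : R)) (by omega)]
      exact sum_shiftCoeff_eq_zero hpos n (by omega)
    rw [adjDiff_iter_eq_sum _ j n (show n - N - 1 + 1 ≤ n - j by omega)]
    have hset : Finset.Icc (n - N - 1 + 1) n = insert n (Finset.Ioc (n - N - 1) (n - 1)) := by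
      ext k
      simp only [Finset.mem_Icc, Finset.mem_insert, Finset.mem_Ioc]
      omega
    rw [hset, Finset.sum_insert (by simp), hd, ← Finset.mul_sum]
    have hc : ∀ k ∈ Finset.Ioc (n - N - 1) (n - 1),
        (shiftCoeff j (n - k) : R) * (P.pos.coeff j k * g k) =
          g k * (P.pos.coeff j k * (shiftCoeff j (n - k) : R)) := fun k _ => by ring
    rw [Finset.sum_congr rfl hc]
    ring
  rw [h1, Finset.sum_congr rfl h2, Finset.sum_sub_distrib, ← Finset.mul_sum, Finset.sum_comm,
    Finset.sum_comm (s := Finset.range (N + 1))]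
  congr 1
  · refine Finset.sum_congr rfl fun k hk => ?_
    rw [P.ker_eq_sum_range hP (show k < n by rw [Finset.mem_Ioc] at hk; omega), Finset.mul_sum]
  · congr 1
    refine Finset.sum_congr rfl fun m hm => ?_
    rw [P.ker_eq_sum_range hP (Finset.mem_Ioc.1 hm).1]

end Action

/-! ### Powers of the Lax kernel -/

section Powers

variable {R : Type*} [CommRing R]

/-- The powers of a kernel under composition. -/
def kerPow (K : ℤ → ℤ → R) : ℕ → ℤ → ℤ → R
  | 0 => fun n m => if m = n then 1 else 0
  | s + 1 => kerMul K (kerPow K s)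

theorem PsdDiff.ker_one : (PsdDiff.one : PsdDiff R).ker = fun n m => if m = n then 1 else 0 := by
  funext n m
  have h0 : ∀ j : ℤ, 0 < j → (PsdDiff.one : PsdDiff R).coeff j = 0 :=
    fun j hj => if_neg (by omega)
  split_ifs with hnm
  · subst hnm
    rw [PsdDiff.ker_eq_sum _ h0 m m (A := 0) (B := 0) (by omega) le_rfl]
    simp [PsdDiff.one, shiftCoeff]
  · rcases lt_or_ge n m with h1 | h1
    · exact PsdDiff.banded_ker h0 n m (by omega)
    · rw [PsdDiff.ker_eq_sum _ h0 n m le_rfl le_rfl]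
      refine Finset.sum_eq_zero fun j _ => ?_
      by_cases hj : j = 0
      · obtain ⟨d, hd⟩ : ∃ d : ℕ, m - n = 0 - ((d + 1 : ℕ) : ℤ) :=
          ⟨(n - m - 1).toNat, by omega⟩
        rw [hj, hd, shiftCoeff_sub_natCast]
        simp
      · simp [PsdDiff.one, hj]

theorem PsdDiff.ker_pow (P : PsdDiff R) (s : ℕ) : (P.pow s).ker = kerPow P.ker s := by
  induction s with
  | zero => exact PsdDiff.ker_one
  | succ s ih => rw [PsdDiff.pow, PsdDiff.ker_mul, ih, kerPow]

theorem PsdDiff.pow_coeff_of_lt {P : PsdDiff R} (hP : ∀ j, 1 < j → P.coeff j = 0) (s : ℕ) (j : ℤ)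
    (hj : (s : ℤ) < j) : (P.pow s).coeff j = 0 := by
  induction s generalizing j with
  | zero => exact if_neg (by push_cast at hj; omega)
  | succ s ih => exact PsdDiff.mul_coeff_of_lt hP ih j (by push_cast at hj; omega)

theorem Banded.kerPow {K : ℤ → ℤ → R} (hK : Banded 1 K) (s : ℕ) : Banded s (kerPow K s) := by
  induction s with
  | zero =>
    intro n m hnm
    exact if_neg (by push_cast at hnm; omega)
  | succ s ih =>
    have := hK.kerMul ih
    rwa [show (1 : ℤ) + s = ((s + 1 : ℕ) : ℤ) by push_cast; ring] at this

theorem kerMul_one_left (K : ℤ → ℤ → R) :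
    kerMul (fun n m => if m = n then 1 else 0) K = K := by
  funext n m
  rw [kerMul, finsum_eq_single _ n fun k hk => by simp [hk]]
  simp

theorem kerMul_one_right (K : ℤ → ℤ → R) :
    kerMul K (fun n m => if m = n then 1 else 0) = K := by
  funext n m
  rw [kerMul, finsum_eq_single _ m fun k hk => by simp [hk.symm]]
  simp

theorem kerPow_one (K : ℤ → ℤ → R) : kerPow K 1 = K := kerMul_one_right K

theorem kerPow_succ' {K : ℤ → ℤ → R} (hK : Banded 1 K) (s : ℕ) :
    kerPow K (s + 1) = kerMul (kerPow K s) K := by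
  induction s with
  | zero => rw [kerPow_one, kerPow, kerMul_one_left]
  | succ s ih =>
    calc kerPow K (s + 1 + 1) = kerMul K (kerPow K (s + 1)) := rfl
      _ = kerMul K (kerMul (kerPow K s) K) := by rw [ih]
      _ = kerMul (kerPow K (s + 1)) K := (kerMul_assoc hK (hK.kerPow s) hK).symm

end Powers

section Tails

variable {R : Type*} [CommRing R]

/-- The tail `∑_{m > n} K k m * f m` of the `k`-th row of a kernel, with weights `f`. -/
def rowTail (K : ℤ → ℤ → R) (f : ℤ → R) (k n : ℤ) : R := upSum (fun m => K k m * f m) n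

/-- The sum `∑_{k ≤ n < m} β k * K k m * f m` over the corner of a kernel above and to the right of
the diagonal entry `n`. -/
def cornerSum (K : ℤ → ℤ → R) (β f : ℤ → R) (n : ℤ) : R :=
  downSum (fun k => β k * rowTail K f k n) n

/-- The sequence `(P_{≥ 1} f) n = ∑_{m > n} K n m * (f m - f n)` for the kernel `K` of `P`. -/
def posAct (K : ℤ → ℤ → R) (f : ℤ → R) (n : ℤ) : R := rowTail K f n n - f n * rowTail K 1 n n

variable {K : ℤ → ℤ → R} {p : ℤ}

theorem rowTail_sub_one (hK : Banded p K) (f : ℤ → R) (k n : ℤ) :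
    rowTail K f k (n - 1) = K k n * f n + rowTail K f k n :=
  upSum_sub_one (N := k + p) (fun m hm => by rw [hK k m hm, zero_mul]) n

theorem rowTail_eq_zero (hK : Banded p K) (f : ℤ → R) {k n : ℤ} (hkn : k + p ≤ n) :
    rowTail K f k n = 0 :=
  upSum_eq_zero fun m hm => by rw [hK k m (by omega), zero_mul]

theorem rowTail_one (K : ℤ → ℤ → R) (k n : ℤ) : rowTail K 1 k n = upSum (K k) n := by
  simp [rowTail]

theorem PsdDiff.act_pos_eq_posAct (P : PsdDiff R) (f : ℤ → R) : P.pos.act f = posAct P.ker f := by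
  funext n
  obtain ⟨p, hp⟩ := P.bdd
  have hK := PsdDiff.banded_ker hp
  rw [PsdDiff.act_pos, posAct, rowTail, rowTail,
    upSum_eq_sum (N := n + p) n fun m _ hm => by rw [hK n m hm, zero_mul],
    upSum_eq_sum (N := n + p) n fun m _ hm => by rw [hK n m hm, zero_mul],
    upSum_eq_sum (N := n + p) n fun m _ hm => by rw [hK n m hm, zero_mul], Finset.mul_sum,
    ← Finset.sum_sub_distrib]
  exact Finset.sum_congr rfl fun m _ => by simp; ring

/-- The column sum `∑_{k < n} β k * K k n` through the differences of the corner sums. -/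
theorem cornerSum_sub_cornerSum (hK : Banded p K) (β f : ℤ → R) (n : ℤ) :
    cornerSum K β f n - cornerSum K β f (n - 1) =
      β n * rowTail K f n n - f n * downSum (fun k => β k * K k n) (n - 1) := by
  have h0 : ∀ k, k ≤ n - p - 1 → β k * rowTail K f k n = 0 := fun k hk => by
    rw [rowTail_eq_zero hK f (by omega), mul_zero]
  have h1 : ∀ k, k ≤ n - p - 1 → β k * K k n = 0 := fun k hk => by
    rw [hK k n (by omega), mul_zero]
  have h2 : (fun k => β k * rowTail K f k (n - 1)) =
      fun k => f n * (β k * K k n) + β k * rowTail K f k n := by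
    funext k
    rw [rowTail_sub_one hK]
    ring
  rw [cornerSum, cornerSum, downSum_sub_one h0, h2,
    downSum_add (fun k hk => by rw [h1 k hk, mul_zero]) h0, downSum_const_mul h1]
  ring

theorem downSum_mul_ker (hK : Banded p K) (β : ℤ → R) (n : ℤ) :
    downSum (fun k => β k * K k n) (n - 1) =
      β n * rowTail K 1 n n - bwdDiff (cornerSum K β 1) n := by
  have := cornerSum_sub_cornerSum hK β 1 n
  rw [Pi.one_apply, one_mul] at this
  rw [bwdDiff, this]
  ring

theorem bwdDiff_cornerSum (hK : Banded p K) (β f : ℤ → R) (n : ℤ) :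
    bwdDiff (cornerSum K β f) n =
      β n * posAct K f n + f n * bwdDiff (cornerSum K β 1) n := by
  rw [bwdDiff, cornerSum_sub_cornerSum hK, downSum_mul_ker hK, posAct]
  ring

/-- The adjoint of `P_{≥ 1}` is a difference of corner sums: with `P_{≥ 1} = B Δ`, one has
`(P_{≥ 1})* β = Δ* (B* β)`. -/
theorem PsdDiff.adjAct_pos_eq (P : PsdDiff R) (β : ℤ → R) (n : ℤ) :
    P.pos.adjAct β n = -bwdDiff (cornerSum P.ker β 1) n := by
  obtain ⟨p, hp⟩ := P.bdd
  rw [PsdDiff.adjAct_pos, downSum_mul_ker (PsdDiff.banded_ker hp), rowTail_one]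
  ring

end Tails

section LaxKernel

variable {K : Type*} [Field K]

/-- The leading coefficient `h⁻¹ (1 + h a b)` of the Lax operator. -/
def laxLead (h : K) (a b : ℤ → K) (n : ℤ) : K := h⁻¹ * (1 + h * a n * b n)

/-- The kernel of `h⁻¹ (1 + h a b) Δ + a Δ⁻¹ b Δ = h⁻¹ (1 + h a E Δ⁻¹ b) Δ`. -/
def laxKer (h : K) (a b : ℤ → K) (n m : ℤ) : K :=
  if m = n + 1 then laxLead h a b n
  else if m = n then a n * b (n - 1) - laxLead h a b n
  else if m < n then -(a n * bwdDiff b m)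
  else 0

theorem banded_laxKer (h : K) (a b : ℤ → K) : Banded 1 (laxKer h a b) := by
  intro n m hnm
  rw [laxKer, if_neg (by omega), if_neg (by omega), if_neg (by omega)]

variable {h : K} {a b : ℤ → K} {l : ℤ → ℤ → K} {p : ℤ}

theorem kerMul_laxKer_left (hl : Banded p l) (n m : ℤ) :
    kerMul (laxKer h a b) l n m = laxLead h a b n * (l (n + 1) m - l n m) +
      a n * (b (n - 1) * l n m - downSum (fun k => bwdDiff b k * l k m) (n - 1)) := by
  set A := min (m - p) n with hA
  have hA1 : A ≤ m - p := min_le_left _ _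
  have hA2 : A ≤ n := min_le_right _ _
  rw [kerMul_eq_sum (banded_laxKer h a b) hl n m hA1 le_rfl,
    downSum_eq_sum (N := A - 1) (n - 1) fun k _ hk => by rw [hl k m (by omega), mul_zero]]
  have hset : Finset.Icc A (n + 1) = insert (n + 1) (insert n (Finset.Ioc (A - 1) (n - 1))) := by
    ext k
    simp only [Finset.mem_Icc, Finset.mem_insert, Finset.mem_Ioc]
    omega
  have hsum : ∑ k ∈ Finset.Ioc (A - 1) (n - 1), laxKer h a b n k * l k m =
      -(a n * ∑ k ∈ Finset.Ioc (A - 1) (n - 1), bwdDiff b k * l k m) := by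
    rw [Finset.mul_sum, ← Finset.sum_neg_distrib]
    refine Finset.sum_congr rfl fun k hk => ?_
    rw [Finset.mem_Ioc] at hk
    rw [laxKer, if_neg (by omega), if_neg (by omega), if_pos (by omega)]
    ring
  rw [hset, Finset.sum_insert (by simp), Finset.sum_insert (by simp), hsum, laxKer,
    if_pos rfl, laxKer, if_neg (by omega), if_pos rfl]
  ring

theorem kerMul_laxKer_right (hl : Banded p l) (k m : ℤ) :
    kerMul l (laxKer h a b) k m = l k (m - 1) * laxLead h a b (m - 1) +
      l k m * (a m * b (m - 1) - laxLead h a b m) - bwdDiff b m * rowTail l a k m := by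
  set B := max (k + p) m with hB
  have hB1 : k + p ≤ B := le_max_left _ _
  have hB2 : m ≤ B := le_max_right _ _
  rw [kerMul_eq_sum hl (banded_laxKer h a b) k m le_rfl hB1, rowTail,
    upSum_eq_sum (N := B) m fun j _ hj => by rw [hl k j (by omega), zero_mul]]
  have hset : Finset.Icc (m - 1) B = insert (m - 1) (insert m (Finset.Ioc m B)) := by
    ext j
    simp only [Finset.mem_Icc, Finset.mem_insert, Finset.mem_Ioc]
    omega
  have hsum : ∑ j ∈ Finset.Ioc m B, l k j * laxKer h a b j m =
      -(bwdDiff b m * ∑ j ∈ Finset.Ioc m B, l k j * a j) := by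
    rw [Finset.mul_sum, ← Finset.sum_neg_distrib]
    refine Finset.sum_congr rfl fun j hj => ?_
    rw [Finset.mem_Ioc] at hj
    rw [laxKer, if_neg (by omega), if_neg (by omega), if_pos (by omega)]
    ring
  rw [hset, Finset.sum_insert (by simp), Finset.sum_insert (by simp), hsum, laxKer,
    if_pos (by omega), laxKer, if_neg (by omega), if_pos rfl]
  ring

theorem rowTail_kerMul_left (hl : Banded p l) (f : ℤ → K) (n q : ℤ) :
    rowTail (kerMul (laxKer h a b) l) f n q =
      laxLead h a b n * (rowTail l f (n + 1) q - rowTail l f n q) +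
        a n * (b (n - 1) * rowTail l f n q -
          downSum (fun k => bwdDiff b k * rowTail l f k q) (n - 1)) := by
  symm
  have hb := (banded_laxKer h a b).kerMul hl
  refine eq_upSum (N := n + (1 + p))
    (X := fun q => laxLead h a b n * (rowTail l f (n + 1) q - rowTail l f n q) +
        a n * (b (n - 1) * rowTail l f n q -
          downSum (fun k => bwdDiff b k * rowTail l f k q) (n - 1)))
    (fun m hm => by rw [hb n m hm, zero_mul]) (fun q => ?_) (fun q hq => ?_) q
  · have h0 : ∀ k, k ≤ q - p - 1 → bwdDiff b k * rowTail l f k q = 0 := fun k hk => by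
      rw [rowTail_eq_zero hl f (by omega), mul_zero]
    have h1 : ∀ k, k ≤ q - p - 1 → bwdDiff b k * l k q = 0 := fun k hk => by
      rw [hl k q (by omega), mul_zero]
    have h2 : (fun k => bwdDiff b k * rowTail l f k (q - 1)) =
        fun k => f q * (bwdDiff b k * l k q) + bwdDiff b k * rowTail l f k q := by
      funext k
      rw [rowTail_sub_one hl]
      ring
    rw [h2, downSum_add (fun k hk => by rw [h1 k hk, mul_zero]) h0, downSum_const_mul h1,
      rowTail_sub_one hl, rowTail_sub_one hl, kerMul_laxKer_left hl]
    ring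
  · rw [rowTail_eq_zero hl f (by omega), rowTail_eq_zero hl f (by omega), downSum_eq_zero]
    · ring
    · intro k hk
      rw [rowTail_eq_zero hl f (by omega), mul_zero]

theorem rowTail_kerMul_left_self (hl : Banded p l) (f : ℤ → K) (n : ℤ) :
    rowTail (kerMul (laxKer h a b) l) f n n =
      laxLead h a b n * (rowTail l f (n + 1) n - rowTail l f n n) +
        a n * (b n * rowTail l f n n - cornerSum l (bwdDiff b) f n) := by
  have h0 : ∀ k, k ≤ n - p - 1 → bwdDiff b k * rowTail l f k n = 0 := fun k hk => by
    rw [rowTail_eq_zero hl f (by omega), mul_zero]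
  rw [rowTail_kerMul_left hl, cornerSum, downSum_sub_one h0 n]
  simp only [bwdDiff]
  ring

theorem rowTail_kerMul_right (h0 : h ≠ 0) (hl : Banded p l) (k n : ℤ) :
    rowTail (kerMul l (laxKer h a b)) 1 k n =
      laxLead h a b n * l k n + b n * rowTail l a k n := by
  symm
  have hb := hl.kerMul (banded_laxKer h a b)
  refine eq_upSum (N := k + (p + 1))
    (X := fun n => laxLead h a b n * l k n + b n * rowTail l a k n)
    (fun m hm => by rw [hb k m hm, zero_mul]) (fun q => ?_) (fun q hq => ?_) n
  · rw [rowTail_sub_one hl, kerMul_laxKer_right hl]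
    simp only [laxLead, bwdDiff, Pi.one_apply]
    field_simp
    ring
  · rw [rowTail_eq_zero hl a (by omega), hl k q (by omega)]
    ring

/-- The step `s → s + 1` for the action of `(Lˢ)_{≥ 1}` on `a`, from `Lˢ⁺¹ = L Lˢ`. The row tail is
the shift of the coefficient of `Δ⁰` in `Lˢ`. -/
theorem posAct_kerMul_left (hl : Banded p l) (n : ℤ) :
    posAct (kerMul (laxKer h a b) l) a n =
      laxLead h a b n * (fwdDiff 1 (posAct l a) n + fwdDiff 1 a n * rowTail l 1 (n + 1) n) +
        a n * (b n * posAct l a n - cornerSum l (bwdDiff b) a n +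
          a n * cornerSum l (bwdDiff b) 1 n) := by
  have h1 := rowTail_sub_one hl a (n + 1) (n + 1)
  have h2 := rowTail_sub_one hl 1 (n + 1) (n + 1)
  rw [add_sub_cancel_right] at h1 h2
  rw [posAct, rowTail_kerMul_left_self hl, rowTail_kerMul_left_self hl]
  simp only [fwdDiff, posAct, h1, h2, Pi.one_apply]
  ring

/-- The step `s → s + 1` for the corner sums of the kernel of `Lˢ`, from `Lˢ⁺¹ = Lˢ L`. -/
theorem cornerSum_kerMul_right (h0 : h ≠ 0) (hl : Banded p l) (n : ℤ) :
    cornerSum (kerMul l (laxKer h a b)) (bwdDiff b) 1 n =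
      laxLead h a b n * (bwdDiff b n * rowTail l 1 n (n - 1) -
        bwdDiff (cornerSum l (bwdDiff b) 1) n) + b n * cornerSum l (bwdDiff b) a n := by
  have h1 : ∀ k, k ≤ n - p - 1 → bwdDiff b k * rowTail l a k n = 0 := fun k hk => by
    rw [rowTail_eq_zero hl a (by omega), mul_zero]
  have h2 : ∀ k, k ≤ n - p - 1 → bwdDiff b k * l k n = 0 := fun k hk => by
    rw [hl k n (by omega), mul_zero]
  have h3 : (fun k => bwdDiff b k * rowTail (kerMul l (laxKer h a b)) 1 k n) = fun k =>
      laxLead h a b n * (bwdDiff b k * l k n) + b n * (bwdDiff b k * rowTail l a k n) := by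
    funext k
    rw [rowTail_kerMul_right h0 hl]
    ring
  rw [cornerSum, h3, downSum_add (fun k hk => by rw [h2 k hk, mul_zero])
    (fun k hk => by rw [h1 k hk, mul_zero]), downSum_const_mul h2, downSum_const_mul h1,
    downSum_sub_one h2, downSum_mul_ker hl, rowTail_sub_one hl, ← cornerSum, Pi.one_apply]
  ring

/-- The comparison of `L Lˢ` and `Lˢ L` gives the differences of the coefficient of `Δ⁰` in `Lˢ`,
which is the full row tail `∑_{m ≥ n}` of the kernel. -/
theorem laxLead_mul_rowTail_sub (h0 : h ≠ 0) (hl : Banded p l)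
    (hcomm : kerMul (laxKer h a b) l = kerMul l (laxKer h a b)) (n : ℤ) :
    laxLead h a b n * (rowTail l 1 (n + 1) n - rowTail l 1 n (n - 1)) =
      b n * posAct l a n + a n * cornerSum l (bwdDiff b) 1 n := by
  have h1 := rowTail_kerMul_left_self (h := h) (a := a) (b := b) hl 1 n
  rw [hcomm, rowTail_kerMul_right h0 hl] at h1
  rw [rowTail_sub_one hl, Pi.one_apply, posAct]
  linear_combination -h1

end LaxKernel

/-! ### Leibniz rule and the coefficients of the commutator -/

section Leibniz

variable {R : Type*} [CommRing R]

theorem choose_neg_one (i : ℕ) : Ring.choose (-1 : ℤ) i = (-1) ^ i := by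
  rw [Ring.choose_neg', Ring.multichoose_one]
  simp [Int.negOnePow, Units.smul_def]

/-- `C(-(j + 1 - i), i) = (-1)ⁱ C(j, i)`. -/
theorem choose_sub_natCast_sub_one (i j : ℕ) :
    Ring.choose ((i : ℤ) - j - 1) i = (-1) ^ i * (j.choose i : ℤ) := by
  rw [show (i : ℤ) - j - 1 = -((j : ℤ) + 1 - i) by ring, Ring.choose_neg,
    show (j : ℤ) + 1 - i + i - 1 = (j : ℤ) by ring,
    show Ring.choose (j : ℤ) i = _ from Ring.choose_natCast j i]
  simp [Int.negOnePow, Units.smul_def]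

/-- `Δ^{j+1} = E Δʲ - Δʲ`. -/
theorem shiftCoeff_add_one (j r : ℤ) :
    shiftCoeff (j + 1) r = shiftCoeff j (r - 1) - shiftCoeff j r := by
  rcases lt_or_ge j r with h1 | h1
  · rw [shiftCoeff_of_lt h1, sub_zero]
    rcases lt_or_ge (j + 1) r with h2 | h2
    · rw [shiftCoeff_of_lt h2, shiftCoeff_of_lt (by omega)]
    · rw [show r = j + 1 - (0 : ℕ) by push_cast; omega, shiftCoeff_sub_natCast,
        show j + 1 - ((0 : ℕ) : ℤ) - 1 = j - (0 : ℕ) by push_cast; omega, shiftCoeff_sub_natCast]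
      simp
  · obtain ⟨d, hd⟩ : ∃ d : ℕ, r = j - d := ⟨(j - r).toNat, by omega⟩
    rw [hd, show j - (d : ℤ) - 1 = j - ((d + 1 : ℕ) : ℤ) by push_cast; ring,
      shiftCoeff_sub_natCast, shiftCoeff_sub_natCast,
      show j - (d : ℤ) = j + 1 - ((d + 1 : ℕ) : ℤ) by push_cast; ring, shiftCoeff_sub_natCast,
      Ring.choose_succ_succ]
    ring

theorem shiftCoeff_neg_one (r : ℤ) : shiftCoeff (-1) r = if r ≤ -1 then 1 else 0 := by
  rw [shiftCoeff]
  split_ifs with hr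
  · rw [choose_neg_one, ← mul_pow]
    simp
  · rfl

theorem shiftCoeff_one (r : ℤ) :
    shiftCoeff 1 r = if r = 1 then 1 else if r = 0 then -1 else 0 := by
  have h0 : ∀ r, shiftCoeff 0 r = if r = 0 then 1 else 0 := by
    intro r
    rw [show (0 : ℤ) = -1 + 1 by norm_num, shiftCoeff_add_one, shiftCoeff_neg_one,
      shiftCoeff_neg_one]
    split_ifs <;> omega
  rw [show (1 : ℤ) = 0 + 1 by norm_num, shiftCoeff_add_one, h0, h0]
  split_ifs <;> omega

theorem fwdDiff_iter_mul (f g : ℤ → R) (j : ℕ) (n : ℤ) :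
    ((fwdDiff (1 : ℤ))^[j] (fun k => f k * g k)) n = ∑ i ∈ Finset.range (j + 1),
      (j.choose i : R) * ((fwdDiff (1 : ℤ))^[i] f) (n + j - i) *
        ((fwdDiff (1 : ℤ))^[j - i] g) n := by
  rw [fwdDiff_one_iter_eq_sum _ j n le_rfl]
  have h1 : ∀ m ∈ Finset.Icc n (n + j), (shiftCoeff j (m - n) : R) * (f m * g m) =
      ∑ i ∈ Finset.range (j + 1), (j.choose i : R) * ((fwdDiff (1 : ℤ))^[i] f) (n + j - i) *
        ((shiftCoeff ((j - i : ℕ) : ℤ) (m - n) : R) * g m) := by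
    intro m hm
    rw [Finset.mem_Icc] at hm
    have hL := shiftCoeff_leibniz f j (m - n) n (I := j + 1) (by push_cast; omega)
    rw [show n + (m - n) = m by ring] at hL
    rw [← mul_assoc, hL, Finset.sum_mul]
    refine Finset.sum_congr rfl fun i hi => ?_
    have hi' : i ≤ j := by simpa [Nat.lt_succ_iff] using hi
    rw [show Ring.choose (j : ℤ) i = _ from Ring.choose_natCast j i, Nat.cast_sub hi']
    push_cast
    ring
  rw [Finset.sum_congr rfl h1, Finset.sum_comm]
  refine Finset.sum_congr rfl fun i hi => ?_
  rw [← Finset.mul_sum, fwdDiff_one_iter_eq_sum g (j - i) n (B := n + j) (by omega)]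

theorem fwdDiff_iter_bwdDiff (b : ℤ → R) (i : ℕ) (n : ℤ) :
    ((fwdDiff (1 : ℤ))^[i] (bwdDiff b)) n = ((fwdDiff (1 : ℤ))^[i + 1] b) (n - 1) := by
  have h1 : bwdDiff b = fun k => fwdDiff (1 : ℤ) b (k + (-1)) := by
    funext k
    simp [bwdDiff, fwdDiff, sub_eq_add_neg]
  rw [h1, fwdDiff_iter_comp_add, Function.iterate_succ_apply, sub_eq_add_neg]

end Leibniz

section Commutator

variable {R : Type*} [CommRing R]

theorem PsdDiff.mul_one_coeff (P : PsdDiff R) : (P.mul PsdDiff.one).coeff = P.coeff := by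
  funext k n
  have h1 : ∀ x : ℤ × ℕ, x ≠ (k, 0) → P.mulTerm PsdDiff.one k n x = 0 := by
    rintro ⟨s, i⟩ hx
    rw [PsdDiff.mulTerm]
    rcases eq_or_ne (k - s + i) 0 with h0 | h0
    · have hi : i ≠ 0 := by
        rintro rfl
        exact hx (by simp only [Prod.mk.injEq, and_true]; push_cast at h0; omega)
      obtain ⟨i, rfl⟩ := Nat.exists_eq_succ_of_ne_zero hi
      simp only [PsdDiff.one, if_pos h0]
      rw [Function.iterate_succ_apply, fwdDiff_const, show (fun _ : ℤ => (0 : R)) = 0 from rfl,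
        PsdDiff.fwdDiff_iter_zero]
      simp
    · simp only [PsdDiff.one, if_neg h0]
      rw [PsdDiff.fwdDiff_iter_zero]
      simp
  refine (finsum_eq_single _ _ h1).trans ?_
  simp [PsdDiff.mulTerm, PsdDiff.one]

variable {A P : PsdDiff R} {g : ℤ → R}

/-- The coefficients of `(g Δ) P`. -/
theorem PsdDiff.mul_coeff_of_left (hA : ∀ j, A.coeff j = if j = 1 then g else 0) (k n : ℤ) :
    (A.mul P).coeff k n =
      g n * (P.coeff (k - 1) (n + 1) + (P.coeff k (n + 1) - P.coeff k n)) := by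
  have h1 : ∀ x : ℤ × ℕ, x ∉ ({(1, 0), (1, 1)} : Finset (ℤ × ℕ)) → A.mulTerm P k n x = 0 := by
    rintro ⟨s, i⟩ hx
    rw [PsdDiff.mulTerm]
    by_cases hs : s = 1
    · subst hs
      have hi : 1 < i := by
        by_contra! hi
        interval_cases i <;> simp at hx
      have : Ring.choose (1 : ℤ) i = 0 := by
        have := Ring.choose_natCast (R := ℤ) 1 i
        rw [Nat.choose_eq_zero_of_lt hi] at this
        simpa using this
      simp [this]
    · simp [hA, hs]
  refine (finsum_eq_sum_of_support_subset _ (s := {(1, 0), (1, 1)}) ?_).trans ?_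
  · intro x hx
    by_contra hx2
    exact hx (h1 x hx2)
  · rw [Finset.sum_pair (by simp)]
    simp [PsdDiff.mulTerm, hA, fwdDiff]
    ring

/-- The coefficients of `P (g Δ)` for `P` of order at most one. -/
theorem PsdDiff.mul_coeff_of_right (hA : ∀ j, A.coeff j = if j = 1 then g else 0)
    (hP : ∀ j, 1 < j → P.coeff j = 0) (k n : ℤ) {I : ℕ} (hI : 2 - k < I) :
    (P.mul A).coeff k n = ∑ i ∈ Finset.range I, ((Ring.choose (k - 1 + i) i : ℤ) : R) *
      P.coeff (k - 1 + i) n * ((fwdDiff (1 : ℤ))^[i] g) (n + k - 1) := by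
  have hinj : Set.InjOn (fun i : ℕ => ((k - 1 + i : ℤ), i)) (Finset.range I) := by
    intro i _ j _ hij
    exact (Prod.mk.inj hij).2
  refine (finsum_eq_sum_of_support_subset _
    (s := (Finset.range I).image fun i : ℕ => ((k - 1 + i : ℤ), i)) ?_).trans ?_
  · rintro ⟨s, i⟩ hx
    have h1 : k - s + i = 1 := by
      by_contra h
      exact hx (by simp [PsdDiff.mulTerm, hA, h, PsdDiff.fwdDiff_iter_zero])
    have h2 : s ≤ 1 := by
      by_contra! h
      exact hx (by simp [PsdDiff.mulTerm, hP s h])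
    simp only [Finset.coe_image, Finset.coe_range, Set.mem_image, Set.mem_Iio, Prod.mk.injEq]
    exact ⟨i, by omega, by omega, rfl⟩
  · rw [Finset.sum_image hinj]
    refine Finset.sum_congr rfl fun i _ => ?_
    simp only [PsdDiff.mulTerm, hA]
    rw [if_pos (by ring), show n + (k - 1 + (i : ℤ)) - i = n + k - 1 by ring]

/-- If two operators of order at most one agree from `Δᵏ` upwards, then the coefficients of `Δᵏ` in
their commutators with `g Δ` differ by a first-order difference expression in the difference of
their next coefficients. -/
theorem PsdDiff.commutator_sub_commutator (hA : ∀ j, A.coeff j = if j = 1 then g else 0)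
    {Q : PsdDiff R} (hP : ∀ j, 1 < j → P.coeff j = 0) (hQ : ∀ j, 1 < j → Q.coeff j = 0)
    {k : ℤ} (hk : k ≤ 1) (hPQ : ∀ j, k ≤ j → P.coeff j = Q.coeff j) (n : ℤ) :
    ((A.mul P).coeff k n - (P.mul A).coeff k n) - ((A.mul Q).coeff k n - (Q.mul A).coeff k n) =
      g n * (P.coeff (k - 1) (n + 1) - Q.coeff (k - 1) (n + 1)) -
        (P.coeff (k - 1) n - Q.coeff (k - 1) n) * g (n + k - 1) := by
  obtain ⟨I, hI⟩ : ∃ I : ℕ, 2 - k < ((I + 1 : ℕ) : ℤ) := ⟨(2 - k).toNat, by omega⟩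
  rw [mul_coeff_of_left hA, mul_coeff_of_left hA, mul_coeff_of_right hA hP k n hI,
    mul_coeff_of_right hA hQ k n hI, Finset.sum_range_succ', Finset.sum_range_succ']
  have h1 : ∀ i ∈ Finset.range I, ((Ring.choose (k - 1 + ((i + 1 : ℕ) : ℤ)) (i + 1) : ℤ) : R) *
      P.coeff (k - 1 + ((i + 1 : ℕ) : ℤ)) n * ((fwdDiff (1 : ℤ))^[i + 1] g) (n + k - 1) =
      ((Ring.choose (k - 1 + ((i + 1 : ℕ) : ℤ)) (i + 1) : ℤ) : R) *
      Q.coeff (k - 1 + ((i + 1 : ℕ) : ℤ)) n * ((fwdDiff (1 : ℤ))^[i + 1] g) (n + k - 1) := by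
    intro i _
    rw [hPQ _ (by push_cast; omega)]
  rw [Finset.sum_congr rfl h1, hPQ k le_rfl]
  simp only [Nat.cast_zero, add_zero, Ring.choose_zero_right, Int.cast_one, one_mul,
    Function.iterate_zero, id_eq]
  ring

end Commutator

section Model

variable {K : Type*} [Field K]

/-- The coefficient of `Δ⁻ⁱ` in `a Δ⁻¹ b Δ`. -/
def symmetryCoeff (a b : ℤ → K) (i : ℕ) (n : ℤ) : K :=
  (-1) ^ i * (a n * ((fwdDiff (1 : ℤ))^[i] b) (n - 1 - i))

/-- The operator `h⁻¹ (1 + h a b) Δ + a Δ⁻¹ b Δ` as a formal series in `Δ`. -/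
def constrainedLax (h : K) (a b : ℤ → K) : PsdDiff K where
  coeff j := if j = 1 then laxLead h a b else if j ≤ 0 then symmetryCoeff a b (-j).toNat else 0
  bdd := ⟨1, fun j hj => by rw [if_neg (by omega), if_neg (by omega)]⟩

theorem constrainedLax_coeff_one (h : K) (a b : ℤ → K) :
    (constrainedLax h a b).coeff 1 = laxLead h a b := by
  simp [constrainedLax]

theorem constrainedLax_coeff_neg (h : K) (a b : ℤ → K) (i : ℕ) :
    (constrainedLax h a b).coeff (-i) = symmetryCoeff a b i := by
  simp only [constrainedLax]
  rw [if_neg (by omega), if_pos (by omega)]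
  simp

theorem constrainedLax_coeff_of_lt (h : K) (a b : ℤ → K) {j : ℤ} (hj : 1 < j) :
    (constrainedLax h a b).coeff j = 0 := by
  simp only [constrainedLax]
  rw [if_neg (by omega), if_neg (by omega)]

theorem ker_constrainedLax (h : K) (a b : ℤ → K) :
    (constrainedLax h a b).ker = laxKer h a b := by
  funext n m
  obtain ⟨I, hI⟩ : ∃ I : ℕ, n - m + 2 ≤ I := ⟨(n - m + 2).toNat, by omega⟩
  rw [PsdDiff.ker_eq_sum _ (fun j hj => constrainedLax_coeff_of_lt h a b hj) n m
    (show min (m - n) (-I) ≤ m - n from min_le_left _ _) le_rfl]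
  have hsplit : ∑ j ∈ Finset.Icc (min (m - n) (-(I : ℤ))) 1,
      (constrainedLax h a b).coeff j n * (shiftCoeff j (m - n) : K) =
      laxLead h a b n * (shiftCoeff 1 (m - n) : K) + ∑ i ∈ Finset.range I,
        symmetryCoeff a b i n * (shiftCoeff (-i) (m - n) : K) := by
    rw [show Finset.Icc (min (m - n) (-(I : ℤ))) 1 =
      insert 1 (Finset.Icc (min (m - n) (-(I : ℤ))) 0) by
        ext j
        simp only [Finset.mem_Icc, Finset.mem_insert]
        omega, Finset.sum_insert (by simp), constrainedLax_coeff_one]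
    congr 1
    symm
    refine Finset.sum_of_injOn (fun i : ℕ => -(i : ℤ)) ?_ ?_ ?_ ?_
    · intro i _ j _ hij
      simpa using hij
    · intro i hi
      simp only [Finset.coe_range, Set.mem_Iio, Finset.coe_Icc, Set.mem_Icc] at hi ⊢
      omega
    · intro j hj hj2
      rw [Finset.mem_Icc] at hj
      rw [shiftCoeff_of_lt, Int.cast_zero, mul_zero]
      by_contra! hcon
      exact hj2 ⟨(-j).toNat, by simp; omega, by simp; omega⟩
    · intro i _
      rw [constrainedLax_coeff_neg]
  have hL : ∀ x : ℤ, -1 - x < I → ∑ i ∈ Finset.range I,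
      (-1 : K) ^ i * ((fwdDiff (1 : ℤ))^[i] b) (n - 1 - i) * (shiftCoeff (-1 - i) x : K) =
        if x ≤ -1 then b (n + x) else 0 := by
    intro x hx
    have := shiftCoeff_leibniz b (-1) x n hx
    rw [shiftCoeff_neg_one] at this
    rw [show (if x ≤ -1 then b (n + x) else 0) =
      (((if x ≤ -1 then 1 else 0 : ℤ) : ℤ) : K) * b (n + x) by split_ifs <;> simp, this]
    refine Finset.sum_congr rfl fun i _ => ?_
    rw [choose_neg_one]
    push_cast
    rw [show n + -1 - (i : ℤ) = n - 1 - i by ring]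
  have htail : ∑ i ∈ Finset.range I, symmetryCoeff a b i n * (shiftCoeff (-i) (m - n) : K) =
      a n * ((if m - n - 1 ≤ -1 then b (n + (m - n - 1)) else 0) -
        if m - n ≤ -1 then b (n + (m - n)) else 0) := by
    rw [← hL (m - n - 1) (by omega), ← hL (m - n) (by omega), ← Finset.sum_sub_distrib,
      Finset.mul_sum]
    refine Finset.sum_congr rfl fun i _ => ?_
    rw [symmetryCoeff, show -(i : ℤ) = -1 - i + 1 by ring, shiftCoeff_add_one]
    push_cast
    ring
  rw [hsplit, htail, shiftCoeff_one, laxKer, show n + (m - n - 1) = m - 1 by ring,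
    show n + (m - n) = m by ring]
  rcases lt_trichotomy m n with h1 | h1 | h1
  · rw [if_neg (by omega), if_neg (by omega), if_pos (by omega), if_pos (by omega),
      if_neg (by omega), if_neg (by omega), if_pos h1, bwdDiff]
    simp
    ring
  · subst h1
    rw [if_neg (by omega), if_pos (by omega), if_pos (by omega), if_neg (by omega),
      if_neg (by omega), if_pos rfl]
    simp
    ring
  · by_cases h2 : m = n + 1
    · rw [if_pos (by omega), if_neg (by omega), if_neg (by omega), if_pos h2]
      simp
    · rw [if_neg (by omega), if_neg (by omega), if_neg (by omega), if_neg (by omega), if_neg h2,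
        if_neg (by omega), if_neg (by omega)]
      simp

variable {h : K} {a b : ℤ → K} {A : PsdDiff K}

theorem constrainedLax_commutator_one
    (hA : ∀ j, A.coeff j = if j = 1 then laxLead h a b else 0) (n : ℤ) :
    (A.mul (constrainedLax h a b)).coeff 1 n - ((constrainedLax h a b).mul A).coeff 1 n =
      laxLead h a b n * fwdDiff 1 a n * b n + a n * (laxLead h a b n * bwdDiff b n) := by
  have h0 := constrainedLax_coeff_neg h a b 0
  rw [Nat.cast_zero, neg_zero] at h0
  rw [PsdDiff.mul_coeff_of_left hA, PsdDiff.mul_coeff_of_right hA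
    (fun j hj => constrainedLax_coeff_of_lt h a b hj) 1 n (I := 2) (by norm_num),
    Finset.sum_range_succ, Finset.sum_range_one]
  norm_num
  rw [h0, constrainedLax_coeff_one]
  simp [symmetryCoeff, fwdDiff, bwdDiff]
  ring

theorem constrainedLax_commutator_neg
    (hA : ∀ j, A.coeff j = if j = 1 then laxLead h a b else 0) (j : ℕ) (n : ℤ) :
    (A.mul (constrainedLax h a b)).coeff (-j) n - ((constrainedLax h a b).mul A).coeff (-j) n =
      (-1) ^ j * (laxLead h a b n * fwdDiff 1 a n * ((fwdDiff (1 : ℤ))^[j] b) (n - 1 - j) +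
        a n * ((fwdDiff (1 : ℤ))^[j] fun k => laxLead h a b k * bwdDiff b k) (n - 1 - j)) := by
  have hright : ((constrainedLax h a b).mul A).coeff (-j) n = (-1) ^ (j + 1) *
      (a n * ((fwdDiff (1 : ℤ))^[j] fun k => laxLead h a b k * bwdDiff b k) (n - 1 - j)) := by
    rw [PsdDiff.mul_coeff_of_right hA
      (fun j hj => constrainedLax_coeff_of_lt h a b hj) (-j) n (I := j + 1 + 1 + 1)
      (by push_cast; omega), Finset.sum_range_succ, Finset.sum_range_succ]
    have e1 : Ring.choose (-(j : ℤ) - 1 + ((j + 1 : ℕ) : ℤ)) (j + 1) = 0 := by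
      rw [show -(j : ℤ) - 1 + ((j + 1 : ℕ) : ℤ) = 0 by push_cast; ring]
      exact Ring.choose_zero_succ ℤ j
    have e2 : Ring.choose (-(j : ℤ) - 1 + ((j + 1 + 1 : ℕ) : ℤ)) (j + 1 + 1) = 0 := by
      rw [show -(j : ℤ) - 1 + ((j + 1 + 1 : ℕ) : ℤ) = ((1 : ℕ) : ℤ) by push_cast; ring,
        show Ring.choose ((1 : ℕ) : ℤ) (j + 1 + 1) = _ from Ring.choose_natCast 1 (j + 1 + 1),
        Nat.choose_eq_zero_of_lt (by omega)]
      rfl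
    rw [e1, e2, show (fun k => laxLead h a b k * bwdDiff b k) =
      fun k => bwdDiff b k * laxLead h a b k from funext fun k => mul_comm _ _,
      fwdDiff_iter_mul, ← Finset.sum_range_reflect, Finset.mul_sum, Finset.mul_sum]
    simp only [Int.cast_zero, zero_mul, add_zero]
    refine Finset.sum_congr rfl fun i hi => ?_
    have hi' : i ≤ j := by simpa [Nat.lt_succ_iff] using hi
    obtain ⟨d, rfl⟩ := Nat.exists_eq_add_of_le hi'
    have e3 : -((i + d : ℕ) : ℤ) - 1 + ((i + d + 1 - 1 - i : ℕ) : ℤ) = -((i + 1 : ℕ) : ℤ) := by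
      push_cast
      omega
    have e4 : i + d + 1 - 1 - i = d := by omega
    have e5 : -((i + d : ℕ) : ℤ) - 1 + (d : ℤ) = (d : ℤ) - (i + d : ℕ) - 1 := by ring
    rw [e3, constrainedLax_coeff_neg, symmetryCoeff, fwdDiff_iter_bwdDiff, ← e3, e4, e5,
      choose_sub_natCast_sub_one, Nat.choose_symm_add, Nat.add_sub_cancel_left]
    push_cast
    rw [show n - 1 - ((i : ℤ) + 1) = n - 2 - i by ring,
      show n - 1 - ((i : ℤ) + d) + (i + d) - i - 1 = n - 2 - i by ring,
      show n + -((i : ℤ) + d) - 1 = n - 1 - (i + d) by ring]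
    ring
  have hleft : (A.mul (constrainedLax h a b)).coeff (-j) n = (-1) ^ j *
      (laxLead h a b n * fwdDiff 1 a n * ((fwdDiff (1 : ℤ))^[j] b) (n - 1 - j)) := by
    have e1 : -(j : ℤ) - 1 = -((j + 1 : ℕ) : ℤ) := by push_cast; ring
    rw [PsdDiff.mul_coeff_of_left hA, e1, constrainedLax_coeff_neg, constrainedLax_coeff_neg]
    simp only [symmetryCoeff, Function.iterate_succ_apply', fwdDiff]
    push_cast
    rw [show n + 1 - 1 - ((j : ℤ) + 1) + 1 = n - j by ring,
      show n + 1 - 1 - ((j : ℤ) + 1) = n - 1 - j by ring,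
      show n + 1 - 1 - (j : ℤ) = n - j by ring]
    ring
  rw [hleft, hright]
  ring

end Model

/-! ### Inverse difference and uniform bounds -/

variable {𝕜 : Type*} [RCLike 𝕜]

section InverseDifference

theorem summable_sub_natCast {E : Type*} [NormedAddCommGroup E] [CompleteSpace E] {f : ℤ → E}
    (hf : Summable f) (n : ℤ) : Summable fun k : ℕ => f (n - k) :=
  hf.comp_injective (i := fun k : ℕ => n - (k : ℤ)) fun i j hij => by simpa using hij

/-- A sequence that tends to zero at `-∞` is recovered from its differences by `Δ⁻¹`. -/
theorem dInv_eq {f X : ℤ → 𝕜} (hf : Summable f) (hX : ∀ n, X (n + 1) - X n = f n)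
    (hX0 : Tendsto X atBot (𝓝 0)) (n : ℤ) : dInv f n = X n := by
  have h1 := (summable_sub_natCast hf (n - 1)).hasSum.tendsto_sum_nat
  have h2 : ∀ N : ℕ, ∑ k ∈ Finset.range N, f (n - 1 - k) = X n - X (n - N) := by
    intro N
    induction N with
    | zero => simp
    | succ N ih =>
      rw [Finset.sum_range_succ, ih, ← hX, show n - 1 - (N : ℤ) + 1 = n - N by ring]
      push_cast
      rw [show n - 1 - (N : ℤ) = n - (N + 1) by ring]
      ring
  have h3 : Tendsto (fun N : ℕ => n - (N : ℤ)) atTop atBot :=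
    tendsto_atTop_atBot.2 fun b => ⟨(n - b).toNat, fun N hN => by omega⟩
  have h4 : Tendsto (fun N : ℕ => X n - X (n - N)) atTop (𝓝 (X n - 0)) :=
    tendsto_const_nhds.sub (hX0.comp h3)
  rw [sub_zero] at h4
  simp only [h2] at h1
  exact tendsto_nhds_unique h1 h4

theorem dInv_add {f g : ℤ → 𝕜} (hf : Summable f) (hg : Summable g) (n : ℤ) :
    dInv (fun k => f k + g k) n = dInv f n + dInv g n :=
  (summable_sub_natCast hf (n - 1)).tsum_add (summable_sub_natCast hg (n - 1))

theorem bwdDiff_dInv {f : ℤ → 𝕜} (hf : Summable f) (n : ℤ) :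
    bwdDiff (fun k => dInv f (k + 1)) n = f n := by
  have h1 := (summable_sub_natCast hf n).tsum_eq_zero_add
  simp only [bwdDiff, dInv]
  rw [show n + 1 - 1 = n by ring, h1, show n - 1 + 1 - 1 = n - 1 by ring]
  push_cast
  simp only [show ∀ k : ℤ, n - (k + 1) = n - 1 - k from fun k => by ring]
  simp

theorem norm_dInv_le {f : ℤ → 𝕜} {ω : ℤ → ℝ} (hω : Summable ω) (hf : ∀ n, ‖f n‖ ≤ ω n) (n : ℤ) :
    ‖dInv f n‖ ≤ ∑' k, ω k := by
  have h0 : ∀ k, 0 ≤ ω k := fun k => (norm_nonneg _).trans (hf k)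
  have hinj : Function.Injective fun k : ℕ => n - 1 - (k : ℤ) := fun i j hij => by simpa using hij
  calc ‖dInv f n‖ ≤ ∑' k : ℕ, ω (n - 1 - k) :=
        tsum_of_norm_bounded (summable_sub_natCast hω (n - 1)).hasSum fun k => hf _
    _ ≤ ∑' k, ω k := tsum_comp_le_tsum_of_inj hω h0 hinj

theorem tendsto_atBot_zero_of_summable {E : Type*} [NormedAddCommGroup E] {f : ℤ → E}
    (hf : Summable f) : Tendsto f atBot (𝓝 0) :=
  hf.tendsto_cofinite_zero.mono_left (by rw [Int.cofinite_eq]; exact le_sup_left)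

theorem summable_sum_Ioc {f : ℤ → ℝ} (hf : Summable f) (c d : ℤ) :
    Summable fun n => ∑ k ∈ Finset.Ioc (n + c) (n + d), f k := by
  have h1 : (fun n => ∑ k ∈ Finset.Ioc (n + c) (n + d), f k) =
      fun n => ∑ i ∈ Finset.Ioc c d, f (n + i) := by
    funext n
    rw [← Finset.map_add_left_Ioc, Finset.sum_map]
    rfl
  rw [h1]
  exact summable_sum fun i _ => hf.comp_injective (add_left_injective i)

end InverseDifference

section Bounds

/-- Uniform bounds on a pair of sequences: `a` and the differences of `b` are dominated by a
summable sequence `ω` with sum at most `B`, and `b` is bounded by `B`. -/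
structure SliceBound (B : ℝ) (ω : ℤ → ℝ) (a b : ℤ → 𝕜) : Prop where
  norm_a_le : ∀ n, ‖a n‖ ≤ ω n
  norm_bwdDiff_le : ∀ n, ‖bwdDiff b n‖ ≤ ω n
  norm_b_le : ∀ n, ‖b n‖ ≤ B
  summable : Summable ω
  tsum_le : ∑' n, ω n ≤ B

namespace SliceBound

variable {B : ℝ} {ω : ℤ → ℝ} {a b : ℤ → 𝕜}

theorem nonneg (H : SliceBound B ω a b) (n : ℤ) : 0 ≤ ω n := (norm_nonneg _).trans (H.norm_a_le n)

theorem bound_nonneg (H : SliceBound B ω a b) : 0 ≤ B := (norm_nonneg _).trans (H.norm_b_le 0)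

theorem norm_a_le_bound (H : SliceBound B ω a b) (n : ℤ) : ‖a n‖ ≤ B :=
  (H.norm_a_le n).trans ((H.summable.le_tsum n fun k _ => H.nonneg k).trans H.tsum_le)

theorem sum_norm_le (H : SliceBound B ω a b) (s : Finset ℤ) : ∑ k ∈ s, ‖bwdDiff b k‖ ≤ B :=
  (Finset.sum_le_sum fun k _ => H.norm_bwdDiff_le k).trans
    ((H.summable.sum_le_tsum s fun k _ => H.nonneg k).trans H.tsum_le)

theorem norm_laxLead_le (H : SliceBound B ω a b) (h : 𝕜) (n : ℤ) :
    ‖laxLead h a b n‖ ≤ ‖h⁻¹‖ * (1 + ‖h‖ * B * B) := by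
  rw [laxLead, norm_mul]
  have h1 : ‖1 + h * a n * b n‖ ≤ 1 + ‖h‖ * B * B := by
    refine (norm_add_le _ _).trans ?_
    rw [norm_one, norm_mul, norm_mul]
    have := H.norm_a_le_bound n
    have := H.norm_b_le n
    have := H.bound_nonneg
    gcongr
  gcongr

theorem norm_downSum_le (H : SliceBound B ω a b) {p N : ℤ} {C : ℝ} {l : ℤ → 𝕜} (hC : 0 ≤ C)
    (hl0 : ∀ k, k ≤ p → l k = 0) (hl : ∀ k, k ≤ N → ‖l k‖ ≤ C) :
    ‖downSum (fun k => bwdDiff b k * l k) N‖ ≤ B * C := by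
  rw [downSum_eq_sum (N := p) N fun k _ hk => by rw [hl0 k hk, mul_zero]]
  calc ‖∑ k ∈ Finset.Ioc p N, bwdDiff b k * l k‖
      ≤ ∑ k ∈ Finset.Ioc p N, ‖bwdDiff b k‖ * C := by
        refine norm_sum_le_of_le _ fun k hk => ?_
        rw [norm_mul]
        have := hl k (Finset.mem_Ioc.1 hk).2
        gcongr
    _ ≤ B * C := by
        rw [← Finset.sum_mul]
        have := H.sum_norm_le (Finset.Ioc p N)
        gcongr

end SliceBound

/-- The kernels of the powers of the Lax operator are bounded, uniformly over all pairs of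
sequences with the same bounds. -/
theorem exists_norm_kerPow_le (h : 𝕜) (B : ℝ) (ω : ℤ → ℝ) (s : ℕ) :
    ∃ C : ℝ, 0 ≤ C ∧ ∀ a b : ℤ → 𝕜, SliceBound B ω a b →
      ∀ n m, ‖kerPow (laxKer h a b) s n m‖ ≤ C := by
  induction s with
  | zero =>
    refine ⟨1, zero_le_one, fun a b _ n m => ?_⟩
    simp only [kerPow]
    split_ifs <;> simp
  | succ s ih =>
    obtain ⟨C, hC, ih⟩ := ih
    refine ⟨max 0 (‖h⁻¹‖ * (1 + ‖h‖ * B * B) * (C + C) + B * (B * C + B * C)), le_max_left _ _,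
      fun a b H n m => le_max_of_le_right ?_⟩
    have hl := (banded_laxKer h a b).kerPow s
    have hB := H.bound_nonneg
    rw [kerPow, kerMul_laxKer_left hl]
    refine (norm_add_le _ _).trans ?_
    rw [norm_mul, norm_mul]
    have h1 : ‖kerPow (laxKer h a b) s (n + 1) m - kerPow (laxKer h a b) s n m‖ ≤ C + C :=
      (norm_sub_le _ _).trans (add_le_add (ih a b H _ _) (ih a b H _ _))
    have h2 : ‖b (n - 1) * kerPow (laxKer h a b) s n m -
        downSum (fun k => bwdDiff b k * kerPow (laxKer h a b) s k m) (n - 1)‖ ≤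
        B * C + B * C := by
      refine (norm_sub_le _ _).trans (add_le_add ?_ ?_)
      · rw [norm_mul]
        have := H.norm_b_le (n - 1)
        have := ih a b H n m
        gcongr
      · exact H.norm_downSum_le (p := m - s - 1) hC (fun k hk => hl k m (by omega))
          fun k _ => ih a b H k m
    have h3 := H.norm_laxLead_le h n
    have h4 := H.norm_a_le_bound n
    gcongr

variable {l : ℤ → ℤ → 𝕜} {s : ℕ} {C : ℝ}

theorem norm_rowTail_le_sum (hl : Banded s l) (hC : ∀ k m, k < m → ‖l k m‖ ≤ C) (f : ℤ → 𝕜)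
    (n : ℤ) : ‖rowTail l f n n‖ ≤ C * ∑ m ∈ Finset.Ioc n (n + s), ‖f m‖ := by
  rw [rowTail, upSum_eq_sum (N := n + s) n fun m _ hm => by rw [hl n m hm, zero_mul],
    Finset.mul_sum]
  refine norm_sum_le_of_le _ fun m hm => ?_
  rw [norm_mul]
  have := hC n m (Finset.mem_Ioc.1 hm).1
  gcongr

theorem norm_rowTail_le (hl : Banded s l) (hC0 : 0 ≤ C) (hC : ∀ k m, k < m → ‖l k m‖ ≤ C)
    {f : ℤ → 𝕜} {F : ℝ} (hF0 : 0 ≤ F) (hF : ∀ m, ‖f m‖ ≤ F) {k n : ℤ} (hkn : k ≤ n) :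
    ‖rowTail l f k n‖ ≤ s * (C * F) := by
  rw [rowTail, upSum_eq_sum (N := k + s) n fun m _ hm => by rw [hl k m hm, zero_mul]]
  have h1 : ∀ m ∈ Finset.Ioc n (k + s), ‖l k m * f m‖ ≤ C * F := fun m hm => by
    rw [norm_mul]
    have := hC k m (by rw [Finset.mem_Ioc] at hm; omega)
    have := hF m
    gcongr
  refine (norm_sum_le_of_le _ h1).trans ?_
  rw [Finset.sum_const, nsmul_eq_mul, Int.card_Ioc]
  have : ((k + s - n).toNat : ℝ) ≤ s := by
    have : (k + s - n).toNat ≤ s := by omega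
    exact_mod_cast this
  gcongr

theorem norm_cornerSum_le (hl : Banded s l) (hC0 : 0 ≤ C) (hC : ∀ k m, k < m → ‖l k m‖ ≤ C)
    {f : ℤ → 𝕜} {F : ℝ} (hF0 : 0 ≤ F) (hF : ∀ m, ‖f m‖ ≤ F) (β : ℤ → 𝕜) (n : ℤ) :
    ‖cornerSum l β f n‖ ≤ s * (C * F) * ∑ k ∈ Finset.Ioc (n + -s) (n + 0), ‖β k‖ := by
  rw [cornerSum, add_zero, downSum_eq_sum (N := n + -s) n fun k _ hk => by
    rw [rowTail_eq_zero hl f (by omega), mul_zero], Finset.mul_sum]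
  refine norm_sum_le_of_le _ fun k hk => ?_
  rw [norm_mul, mul_comm]
  have := norm_rowTail_le hl hC0 hC hF0 hF (Finset.mem_Ioc.1 hk).2
  gcongr

theorem norm_posAct_le (hl : Banded s l) (hC0 : 0 ≤ C) (hC : ∀ k m, k < m → ‖l k m‖ ≤ C)
    (f : ℤ → 𝕜) (n : ℤ) :
    ‖posAct l f n‖ ≤ C * ∑ m ∈ Finset.Ioc (n + 0) (n + s), ‖f m‖ + ‖f n‖ * (s * (C * 1)) := by
  rw [posAct, add_zero]
  refine (norm_sub_le _ _).trans (add_le_add (norm_rowTail_le_sum hl hC f n) ?_)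
  rw [norm_mul]
  have := norm_rowTail_le hl hC0 hC (f := 1) zero_le_one (by simp) (le_refl n)
  gcongr

end Bounds

/-! ### Limits at `-∞` -/

theorem tendsto_zero_mul_of_norm_le {ι : Type*} {F : Filter ι} {f g : ι → 𝕜} {M : ℝ}
    (hf : Tendsto f F (𝓝 0)) (hg : ∀ n, ‖g n‖ ≤ M) : Tendsto (fun n => f n * g n) F (𝓝 0) := by
  refine squeeze_zero_norm (a := fun n => ‖f n‖ * M) (fun n => ?_) ?_
  · rw [norm_mul]
    have := hg n
    gcongr
  · have := hf.norm.mul_const M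
    rwa [norm_zero, zero_mul] at this

theorem tendsto_atBot_add_const {X : ℤ → 𝕜} {x : 𝕜} (hX : Tendsto X atBot (𝓝 x)) (c : ℤ) :
    Tendsto (fun n => X (n + c)) atBot (𝓝 x) :=
  hX.comp (tendsto_atBot_add_const_right _ c tendsto_id)

namespace SliceBound

variable {B : ℝ} {ω : ℤ → ℝ} {a b : ℤ → 𝕜} {h : 𝕜}

theorem summable_a (H : SliceBound B ω a b) : Summable a := .of_norm_bounded H.summable H.norm_a_le

theorem summable_diff_b (H : SliceBound B ω a b) : Summable (bwdDiff b) :=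
  .of_norm_bounded H.summable H.norm_bwdDiff_le

theorem tendsto_laxLead (H : SliceBound B ω a b) (h : 𝕜) :
    Tendsto (laxLead h a b) cofinite (𝓝 h⁻¹) := by
  have h1 := tendsto_zero_mul_of_norm_le H.summable_a.tendsto_cofinite_zero H.norm_b_le
  have h2 := ((h1.const_mul h).const_add 1).const_mul h⁻¹
  rw [mul_zero, add_zero, mul_one] at h2
  refine h2.congr fun n => ?_
  rw [laxLead]
  ring

theorem tendsto_laxLead_atBot (H : SliceBound B ω a b) (h : 𝕜) :
    Tendsto (laxLead h a b) atBot (𝓝 h⁻¹) :=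
  (H.tendsto_laxLead h).mono_left (by rw [Int.cofinite_eq]; exact le_sup_left)

theorem exists_norm_inv_le (H : SliceBound B ω a b) (h0 : h ≠ 0) :
    ∃ M : ℝ, ∀ n, ‖(laxLead h a b n)⁻¹‖ ≤ M := by
  have h1 := ((H.tendsto_laxLead h).inv₀ (inv_ne_zero h0)).norm
  obtain ⟨M, hM⟩ := h1.bddAbove_range_of_cofinite
  exact ⟨M, fun n => hM ⟨n, rfl⟩⟩

/-- Below the diagonal the kernel of `Lˢ` tends to zero at `-∞`. -/
theorem tendsto_kerPow (H : SliceBound B ω a b) (h : 𝕜) (s i : ℕ) :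
    Tendsto (fun n => kerPow (laxKer h a b) s (n + (i + 1)) n) atBot (𝓝 0) := by
  induction s generalizing i with
  | zero =>
    refine tendsto_const_nhds.congr fun n => ?_
    simp only [kerPow]
    rw [if_neg (by omega)]
  | succ s ih =>
    have hl := (banded_laxKer h a b).kerPow s
    obtain ⟨C, hC0, hC⟩ := exists_norm_kerPow_le h B ω s
    have hB := H.bound_nonneg
    have h1 := (tendsto_atBot_add_const (H.tendsto_laxLead_atBot h) (i + 1)).mul
      ((ih (i + 1)).sub (ih i))
    have h2 := tendsto_zero_mul_of_norm_le
      (tendsto_atBot_add_const (tendsto_atBot_zero_of_summable H.summable_a) (i + 1))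
      (g := fun n => b (n + (i + 1) - 1) * kerPow (laxKer h a b) s (n + (i + 1)) n -
        downSum (fun k => bwdDiff b k * kerPow (laxKer h a b) s k n) (n + (i + 1) - 1))
      (M := B * C + B * C) (fun n => by
        refine (norm_sub_le _ _).trans (add_le_add ?_ ?_)
        · rw [norm_mul]
          have := H.norm_b_le (n + (i + 1) - 1)
          have := hC a b H (n + (i + 1)) n
          gcongr
        · exact H.norm_downSum_le (p := n - s - 1) hC0 (fun k hk => hl k n (by omega))
            fun k _ => hC a b H k n)
    have h3 := h1.add h2
    rw [sub_zero, mul_zero, add_zero] at h3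
    refine h3.congr fun n => ?_
    rw [kerPow, kerMul_laxKer_left hl]
    push_cast
    rw [show n + ((i : ℤ) + 1 + 1) = n + (i + 1) + 1 by ring]

/-- The coefficient of `Δ⁰` in `Lˢ` has a limit at `-∞`, which is zero for `s ≥ 1`. -/
theorem exists_tendsto_rowTail (H : SliceBound B ω a b) (h : 𝕜) (s : ℕ) :
    ∃ γ : 𝕜, (s ≠ 0 → γ = 0) ∧
      Tendsto (fun n => rowTail (kerPow (laxKer h a b) s) 1 n (n - 1)) atBot (𝓝 γ) := by
  induction s with
  | zero =>
    refine ⟨1, fun h => absurd rfl h, tendsto_const_nhds.congr fun n => ?_⟩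
    rw [rowTail_sub_one ((banded_laxKer h a b).kerPow 0),
      rowTail_eq_zero ((banded_laxKer h a b).kerPow 0) _ (by simp)]
    simp [kerPow]
  | succ s ih =>
    obtain ⟨γ, -, hγ⟩ := ih
    refine ⟨0, fun _ => rfl, ?_⟩
    have hl := (banded_laxKer h a b).kerPow s
    obtain ⟨C, hC0, hC⟩ := exists_norm_kerPow_le h B ω s
    have hB := H.bound_nonneg
    have hT : ∀ k n, k ≤ n → ‖rowTail (kerPow (laxKer h a b) s) 1 k n‖ ≤ s * (C * 1) :=
      fun k n hkn => norm_rowTail_le hl hC0 (fun k m _ => hC a b H k m) zero_le_one (by simp) hkn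
    have hT' : ∀ n, ‖rowTail (kerPow (laxKer h a b) s) 1 n (n - 1)‖ ≤ C + s * (C * 1) := by
      intro n
      rw [rowTail_sub_one hl, Pi.one_apply, mul_one]
      exact (norm_add_le _ _).trans (add_le_add (hC a b H n n) (hT n n le_rfl))
    have h0 := tendsto_kerPow H h s 0
    have hγ' := tendsto_atBot_add_const hγ 1
    have h1 := (H.tendsto_laxLead_atBot h).mul ((h0.add hγ').sub hγ)
    have h2 := tendsto_zero_mul_of_norm_le (tendsto_atBot_zero_of_summable H.summable_a)
      (g := fun n => b (n - 1) * rowTail (kerPow (laxKer h a b) s) 1 n (n - 1) -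
        downSum (fun k => bwdDiff b k * rowTail (kerPow (laxKer h a b) s) 1 k (n - 1)) (n - 1))
      (M := B * (C + s * (C * 1)) + B * (s * (C * 1))) (fun n => by
        refine (norm_sub_le _ _).trans (add_le_add ?_ ?_)
        · rw [norm_mul]
          have := H.norm_b_le (n - 1)
          have := hT' n
          gcongr
        · exact H.norm_downSum_le (p := n - s - 1) (by positivity)
            (fun k hk => rowTail_eq_zero hl 1 (by omega)) fun k hk => hT k (n - 1) hk)
    have h3 := h1.add h2
    rw [zero_add, sub_self, mul_zero, add_zero] at h3
    refine h3.congr fun n => ?_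
    have h4 := rowTail_sub_one hl 1 (n + 1) n
    simp only [kerPow]
    rw [rowTail_kerMul_left hl, h4]
    simp

end SliceBound

/-! ### The recursion at a fixed time -/

theorem summable_mul_of_norm_le {f g : ℤ → 𝕜} {M : ℝ} (hf : Summable f) (hg : ∀ n, ‖g n‖ ≤ M) :
    Summable fun n => g n * f n := by
  refine .of_norm_bounded (g := fun n => M * ‖f n‖) (hf.norm.mul_left M) fun n => ?_
  rw [norm_mul]
  have := hg n
  gcongr

theorem summable_shift {f : ℤ → 𝕜} (hf : Summable f) (c : ℤ) : Summable fun n => f (n + c) :=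
  hf.comp_injective (add_left_injective c)

theorem summable_fwdDiff {f : ℤ → 𝕜} (hf : Summable f) : Summable (fwdDiff 1 f) :=
  (summable_shift hf 1).sub hf

theorem summable_bwdDiff {f : ℤ → 𝕜} (hf : Summable f) : Summable (bwdDiff f) :=
  (summable_shift hf (-1)).neg.add hf |>.congr fun n => by
    rw [bwdDiff, ← sub_eq_add_neg]
    ring

namespace SliceBound

variable {B : ℝ} {ω : ℤ → ℝ} {a b : ℤ → 𝕜} {h : 𝕜}

theorem summable_cornerSum (H : SliceBound B ω a b) (h : 𝕜) (s : ℕ) {f : ℤ → 𝕜} {F : ℝ}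
    (hF : ∀ n, ‖f n‖ ≤ F) :
    Summable (cornerSum (kerPow (laxKer h a b) s) (bwdDiff b) f) := by
  obtain ⟨C, hC0, hC⟩ := exists_norm_kerPow_le h B ω s
  refine .of_norm_bounded ((summable_sum_Ioc H.summable_diff_b.norm _ _).mul_left _) fun n =>
    norm_cornerSum_le ((banded_laxKer h a b).kerPow s) hC0 (fun k m _ => hC a b H k m)
      ((norm_nonneg _).trans (hF 0)) hF _ n

theorem summable_posAct (H : SliceBound B ω a b) (h : 𝕜) (s : ℕ) :
    Summable (posAct (kerPow (laxKer h a b) s) a) := by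
  obtain ⟨C, hC0, hC⟩ := exists_norm_kerPow_le h B ω s
  exact .of_norm_bounded (((summable_sum_Ioc H.summable_a.norm _ _).mul_left _).add
    (H.summable_a.norm.mul_right _)) fun n => norm_posAct_le
      ((banded_laxKer h a b).kerPow s) hC0 (fun k m _ => hC a b H k m) _ n

/-- The recursion `(u, w) ↦ T (u, w)` at a fixed time, for `u = (Lˢ)_{≥ 1} a` and the corner sums
`w` of the kernel of `Lˢ`, together with the absolute convergence of the sums in it. -/
theorem recursion (H : SliceBound B ω a b) (h0 : h ≠ 0) (hv : ∀ n, 1 + h * a n * b n ≠ 0)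
    {s : ℕ} (hs : s ≠ 0) {u w : ℤ → 𝕜} (hu : u = posAct (kerPow (laxKer h a b) s) a)
    (hw : w = cornerSum (kerPow (laxKer h a b) s) (bwdDiff b) 1) :
    TDefined h a b u w ∧ ∀ n,
      T11 h a b u n + T12 h a b w n = posAct (kerPow (laxKer h a b) (s + 1)) a n ∧
      T21 h a b u n + T22 h a b w n =
        cornerSum (kerPow (laxKer h a b) (s + 1)) (bwdDiff b) 1 n := by
  have hl := (banded_laxKer h a b).kerPow s
  have hcomm : kerMul (laxKer h a b) (kerPow (laxKer h a b) s) =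
      kerMul (kerPow (laxKer h a b) s) (laxKer h a b) :=
    kerPow_succ' (banded_laxKer h a b) s
  have hposAct := posAct_kerMul_left (h := h) (a := a) (b := b) hl
  have hcorner := cornerSum_kerMul_right (h := h) (a := a) (b := b) h0 hl
  have hdiag := laxLead_mul_rowTail_sub (h := h) (a := a) (b := b) h0 hl hcomm
  have hWdiff := bwdDiff_cornerSum hl (bwdDiff b) a
  rw [← hcomm] at hcorner
  have hus := H.summable_posAct h s
  have hws := H.summable_cornerSum h s (f := 1) (F := 1) (by simp)
  have hWs := H.summable_cornerSum h s H.norm_a_le_bound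
  obtain ⟨γ, hγ0, hγ⟩ := H.exists_tendsto_rowTail h s
  rw [hγ0 hs] at hγ
  change ∀ n, posAct (kerPow (laxKer h a b) (s + 1)) a n = _ at hposAct
  change ∀ n, cornerSum (kerPow (laxKer h a b) (s + 1)) (bwdDiff b) 1 n = _ at hcorner
  simp only [hposAct, hcorner]
  rw [← hu] at hdiag hWdiff hus ⊢
  rw [← hw] at hdiag hWdiff hws ⊢
  set W := cornerSum (kerPow (laxKer h a b) s) (bwdDiff b) a with hW
  set c : ℤ → 𝕜 := fun n => rowTail (kerPow (laxKer h a b) s) 1 n (n - 1) with hc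
  have hc1 : ∀ n, rowTail (kerPow (laxKer h a b) s) 1 (n + 1) n = c (n + 1) := fun n => by
    simp [hc]
  have hg0 : ∀ n, laxLead h a b n ≠ 0 := fun n => mul_ne_zero (inv_ne_zero h0) (hv n)
  have hv' : ∀ n, h * a n * b n + 1 ≠ 0 := fun n => by
    rw [add_comm]
    exact hv n
  -- the denominators are bounded away from zero, since they tend to `1` at both ends
  obtain ⟨M, hM⟩ := H.exists_norm_inv_le h0
  have hquot : ∀ (x : 𝕜) (n : ℤ), h * x / (h * a n * b n + 1) = x * (laxLead h a b n)⁻¹ := by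
    intro x n
    have := hv n
    have := hv' n
    rw [laxLead]
    field_simp
    ring
  have hqle : ∀ (x : ℤ → 𝕜), (∀ n, ‖x n‖ ≤ B) →
      ∀ n, ‖h * x n / (h * a n * b n + 1)‖ ≤ B * M := by
    intro x hx n
    rw [hquot, norm_mul]
    have := hx n
    have := hM n
    have := H.bound_nonneg
    gcongr
  -- absolute convergence
  have s1 : Summable fun k => b k * fwdDiff 1 u k :=
    summable_mul_of_norm_le (summable_fwdDiff hus) H.norm_b_le
  have s2 : Summable fun k => h * b k / (h * a k * b k + 1) * u k :=
    summable_mul_of_norm_le hus (hqle b H.norm_b_le)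
  have s3 : Summable fun k => h * a k / (h * a k * b k + 1) * w k :=
    summable_mul_of_norm_le hws (hqle a H.norm_a_le_bound)
  have s4 : Summable fun k => fwdDiff 1 a k * w k :=
    summable_mul_of_norm_le hws fun n =>
      (norm_sub_le _ _).trans (add_le_add (H.norm_a_le_bound (n + 1)) (H.norm_a_le_bound n))
  have s5 : Summable fun k => bwdDiff b k * u k :=
    summable_mul_of_norm_le hus fun n =>
      (norm_sub_le _ _).trans (add_le_add (H.norm_b_le n) (H.norm_b_le (n - 1)))
  have s6 : Summable fun k => a k * bwdDiff w k :=
    summable_mul_of_norm_le (summable_bwdDiff hws) H.norm_a_le_bound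
  refine ⟨⟨s1, s2, s3, s4, s5, s6⟩, ?_⟩
  -- evaluation of the sums
  have d1 : ∀ n, dInv (fun k => b k * fwdDiff 1 u k) n + dInv (fun k => fwdDiff 1 a k * w k) n =
      b n * u n - W n + a n * w n := by
    intro n
    rw [← dInv_add s1 s4]
    refine dInv_eq (X := fun n => b n * u n - W n + a n * w n) (s1.add s4) (fun n => ?_) ?_ n
    · have := hWdiff (n + 1)
      simp only [bwdDiff, add_sub_cancel_right] at this
      simp only [fwdDiff]
      linear_combination -this
    · have t1 := tendsto_zero_mul_of_norm_le (tendsto_atBot_zero_of_summable hus) H.norm_b_le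
      have t2 := tendsto_zero_mul_of_norm_le (tendsto_atBot_zero_of_summable hws)
        H.norm_a_le_bound
      have t3 := (t1.sub (tendsto_atBot_zero_of_summable hWs)).add t2
      rw [sub_zero, add_zero] at t3
      refine t3.congr fun n => ?_
      ring
  have d2 : ∀ n, dInv (fun k => h * b k / (h * a k * b k + 1) * u k) n +
      dInv (fun k => h * a k / (h * a k * b k + 1) * w k) n = c n := by
    intro n
    rw [← dInv_add s2 s3]
    refine dInv_eq (s2.add s3) (fun n => ?_) hγ n
    have hd := hdiag n
    rw [hc1] at hd
    rw [hquot, hquot]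
    apply mul_left_cancel₀ (hg0 n)
    have := hg0 n
    field_simp
    linear_combination hd
  have d3 : ∀ n, dInv (fun k => a k * bwdDiff w k) (n + 1) +
      dInv (fun k => bwdDiff b k * u k) (n + 1) = W n := by
    intro n
    rw [← dInv_add s6 s5]
    -- `Δ⁻¹` recovers `n ↦ W (n - 1)`, because the backward difference of `W` is known
    have hW0 := tendsto_atBot_add_const (tendsto_atBot_zero_of_summable hWs) (-1)
    rw [dInv_eq (s6.add s5) (fun n => ?_) hW0, add_neg_cancel_right]
    have := hWdiff n
    simp only [bwdDiff] at this ⊢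
    rw [add_neg_cancel_right, ← sub_eq_add_neg]
    linear_combination this
  intro n
  have hg : laxLead h a b n = h⁻¹ * (h * a n * b n + 1) := by rw [laxLead, add_comm]
  have hinv := inv_mul_cancel₀ h0
  constructor
  · rw [T11, T12, hc1, ← d2 (n + 1), ← d1 n, hg]
    linear_combination a n * dInv (fun k => b k * fwdDiff 1 u k) n * hinv
  · change _ = laxLead h a b n * (bwdDiff b n * c n - bwdDiff w n) + b n * W n
    rw [T21, T22, ← d2 n, ← d3 n, hg]
    linear_combination b n * dInv (fun k => a k * bwdDiff w k) (n + 1) * hinv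

end SliceBound

/-! ### Differentiation along the times -/

section TimeLines

theorem RapidDecay.exists_majorant {U : Set (ℕ+ → ℝ)} {f : ℤ → (ℕ+ → ℝ) → 𝕜}
    (hf : RapidDecay U f) {t : ℕ+ → ℝ} (ht : t ∈ U) (s : ℕ+) :
    ∃ ω : ℤ → ℝ, Summable ω ∧
      ∀ᶠ τ in 𝓝 (t s), ∀ n, ‖f n (Function.update t s τ)‖ ≤ ω n := by
  obtain ⟨C, hC⟩ := hf t ht s 0
  obtain ⟨D, hD⟩ := hf t ht s 2
  refine ⟨fun n => D * (1 / (n : ℝ) ^ 2) + if n = 0 then C else 0, ?_, ?_⟩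
  · refine ((Real.summable_one_div_int_pow.2 one_lt_two).mul_left D).add ?_
    exact summable_of_ne_finset_zero (s := {0}) fun n hn => if_neg (by simpa using hn)
  · filter_upwards [hC, hD] with τ h1 h2 n
    rcases eq_or_ne n 0 with rfl | hn
    · simpa using h1 0
    · have h3 := h2 n
      have hn' : (0 : ℝ) < |(n : ℝ)| ^ 2 := by positivity
      rw [if_neg hn, add_zero, mul_one_div, ← sq_abs, le_div_iff₀ hn']
      linarith

theorem eventually_sliceBound {U : Set (ℕ+ → ℝ)} {Φ Φs b : ℤ → (ℕ+ → ℝ) → 𝕜} {h : 𝕜}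
    (hΦ : RapidDecay U Φ) (hΦs : RapidDecay U Φs)
    (hb : ∀ n t, b n t = h * dInv (fun k => Φs k t) (n + 1)) {t : ℕ+ → ℝ} (ht : t ∈ U) (s : ℕ+) :
    ∃ (B : ℝ) (ω : ℤ → ℝ), ∀ᶠ τ in 𝓝 (t s),
      SliceBound B ω (fun n => Φ n (Function.update t s τ))
        (fun n => b n (Function.update t s τ)) ∧
      (∀ n, ‖Φs n (Function.update t s τ)‖ ≤ ω n) ∧
      bwdDiff (fun n => b n (Function.update t s τ)) =
        fun n => h * Φs n (Function.update t s τ) := by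
  obtain ⟨ω₁, hω₁, h1⟩ := hΦ.exists_majorant ht s
  obtain ⟨ω₂, hω₂, h2⟩ := hΦs.exists_majorant ht s
  refine ⟨∑' n, (ω₁ n + (1 + ‖h‖) * ω₂ n), fun n => ω₁ n + (1 + ‖h‖) * ω₂ n, ?_⟩
  filter_upwards [h1, h2] with τ g1 g2
  have p1 : ∀ n, 0 ≤ ω₁ n := fun n => (norm_nonneg _).trans (g1 n)
  have p2 : ∀ n, 0 ≤ ω₂ n := fun n => (norm_nonneg _).trans (g2 n)
  have p3 : ∀ n, 0 ≤ ‖h‖ * ω₂ n := fun n => mul_nonneg (norm_nonneg _) (p2 n)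
  have hsum : Summable fun n => ω₁ n + (1 + ‖h‖) * ω₂ n := hω₁.add (hω₂.mul_left _)
  have hs : Summable fun k => Φs k (Function.update t s τ) := .of_norm_bounded hω₂ g2
  have hdiff : bwdDiff (fun n => b n (Function.update t s τ)) =
      fun n => h * Φs n (Function.update t s τ) := by
    funext n
    have := bwdDiff_dInv hs n
    simp only [bwdDiff] at this ⊢
    rw [hb, hb, ← mul_sub, this]
  refine ⟨⟨fun n => ?_, fun n => ?_, fun n => ?_, hsum, le_rfl⟩, fun n => ?_, hdiff⟩
  · have := g1 n
    have := p2 n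
    have := p3 n
    linarith
  · rw [hdiff, norm_mul]
    have := mul_le_mul_of_nonneg_left (g2 n) (norm_nonneg h)
    have := p1 n
    have := p2 n
    linarith
  · rw [hb, norm_mul]
    calc ‖h‖ * ‖dInv (fun k => Φs k (Function.update t s τ)) (n + 1)‖
        ≤ ‖h‖ * ∑' k, ω₂ k := by
          have := norm_dInv_le hω₂ g2 (n + 1)
          gcongr
      _ = ∑' k, ‖h‖ * ω₂ k := tsum_mul_left.symm
      _ ≤ ∑' n, (ω₁ n + (1 + ‖h‖) * ω₂ n) :=
          (hω₂.mul_left _).tsum_le_tsum (fun n => by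
            have := p1 n
            have := p2 n
            linarith) hsum
  · have := g2 n
    have := p1 n
    have := p3 n
    linarith

theorem cornerSum_const_mul {l : ℤ → ℤ → 𝕜} {p : ℤ} (hl : Banded p l) (c : 𝕜) (β f : ℤ → 𝕜)
    (n : ℤ) : cornerSum l (fun k => c * β k) f n = c * cornerSum l β f n := by
  rw [cornerSum, cornerSum, ← downSum_const_mul (N := n - p) fun k hk => by
    rw [rowTail_eq_zero hl f (by omega), mul_zero]]
  simp only [mul_assoc]

/-- If the terms of `Δ⁻¹ f` move along a line by differences of corner sums of uniformly bounded
kernels, then the sum can be differentiated term by term, and its derivative telescopes. -/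
theorem hasDerivAt_dInv {f : ℤ → ℝ → 𝕜} {x₀ : ℝ} {l : ℝ → ℤ → ℤ → 𝕜} {p : ℕ} {C : ℝ}
    {ω : ℤ → ℝ} (hω : Summable ω) (hf : ∀ᶠ τ in 𝓝 x₀, ∀ n, ‖f n τ‖ ≤ ω n)
    (hl : ∀ τ, Banded p (l τ)) (hC0 : 0 ≤ C)
    (hC : ∀ᶠ τ in 𝓝 x₀, ∀ k m, k < m → ‖l τ k m‖ ≤ C)
    (hd : ∀ᶠ τ in 𝓝 x₀, ∀ n,
      HasDerivAt (f n) (bwdDiff (cornerSum (l τ) (fun k => f k τ) 1) n) τ) (n : ℤ) :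
    HasDerivAt (fun τ => dInv (fun k => f k τ) (n + 1))
      (cornerSum (l x₀) (fun k => f k x₀) 1 n) x₀ := by
  set μ : ℤ → ℝ := fun n => p * (C * 1) * ∑ k ∈ Finset.Ioc (n + -p) (n + 0), ω k with hμ
  have hμs : Summable μ := (summable_sum_Ioc hω _ _).mul_left _
  have hcorner : ∀ τ, (∀ n, ‖f n τ‖ ≤ ω n) → (∀ k m, k < m → ‖l τ k m‖ ≤ C) →
      ∀ n, ‖cornerSum (l τ) (fun k => f k τ) 1 n‖ ≤ μ n := by
    intro τ h1 h2 n
    refine (norm_cornerSum_le (hl τ) hC0 h2 zero_le_one (by simp) _ n).trans ?_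
    have : ∑ k ∈ Finset.Ioc (n + -(p : ℤ)) (n + 0), ‖f k τ‖ ≤
      ∑ k ∈ Finset.Ioc (n + -(p : ℤ)) (n + 0), ω k := Finset.sum_le_sum fun k _ => h1 k
    simp only [hμ]
    gcongr
  obtain ⟨ε, hε, hball⟩ := Metric.eventually_nhds_iff_ball.1 (hf.and (hC.and hd))
  have hx₀ : x₀ ∈ Metric.ball x₀ ε := Metric.mem_ball_self hε
  have hμ' : Summable fun n => μ n + μ (n - 1) :=
    hμs.add (hμs.comp_injective (sub_left_injective (b := 1)))
  have hbound : ∀ τ ∈ Metric.ball x₀ ε, ∀ n,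
      ‖bwdDiff (cornerSum (l τ) (fun k => f k τ) 1) n‖ ≤ μ n + μ (n - 1) := by
    intro τ hτ n
    obtain ⟨h1, h2, -⟩ := hball τ hτ
    exact (norm_sub_le _ _).trans (add_le_add (hcorner τ h1 h2 n) (hcorner τ h1 h2 (n - 1)))
  have hx₀sum : Summable fun k : ℕ => f (n + 1 - 1 - k) x₀ :=
    summable_sub_natCast (f := fun k => f k x₀) (.of_norm_bounded hω (hball x₀ hx₀).1) (n + 1 - 1)
  have hμsum : Summable fun k : ℕ => μ (n + 1 - 1 - k) + μ (n + 1 - 1 - k - 1) :=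
    summable_sub_natCast (f := fun n => μ n + μ (n - 1)) hμ' (n + 1 - 1)
  have key : HasDerivAt (fun τ => ∑' k : ℕ, f (n + 1 - 1 - k) τ)
      (∑' k : ℕ, bwdDiff (cornerSum (l x₀) (fun k => f k x₀) 1) (n + 1 - 1 - k)) x₀ :=
    hasDerivAt_tsum_of_isPreconnected
      (g' := fun (k : ℕ) τ => bwdDiff (cornerSum (l τ) (fun k => f k τ) 1) (n + 1 - 1 - k))
      hμsum Metric.isOpen_ball (convex_ball x₀ ε).isPreconnected
      (fun k τ hτ => (hball τ hτ).2.2 _) (fun k τ hτ => hbound τ hτ _) hx₀ hx₀sum hx₀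
  have hsum : dInv (bwdDiff (cornerSum (l x₀) (fun k => f k x₀) 1)) (n + 1) =
      cornerSum (l x₀) (fun k => f k x₀) 1 n := by
    have h0 : Summable (cornerSum (l x₀) (fun k => f k x₀) 1) :=
      .of_norm_bounded hμs (hcorner x₀ (hball x₀ hx₀).1 (hball x₀ hx₀).2.1)
    rw [dInv_eq (summable_bwdDiff h0) (fun k => ?_)
      (tendsto_atBot_add_const (tendsto_atBot_zero_of_summable h0) (-1))]
    · rw [add_neg_cancel_right]
    · rw [add_neg_cancel_right, bwdDiff, sub_eq_add_neg k]
  rw [← hsum]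
  exact key

theorem hasDerivAt_fwdDiff_iter {f : ℤ → ℝ → 𝕜} {f' : ℤ → 𝕜} {x₀ : ℝ}
    (hf : ∀ n, HasDerivAt (f n) (f' n) x₀) (j : ℕ) (n : ℤ) :
    HasDerivAt (fun τ => ((fwdDiff (1 : ℤ))^[j] fun k => f k τ) n)
      (((fwdDiff (1 : ℤ))^[j] f') n) x₀ := by
  induction j generalizing n with
  | zero => exact hf n
  | succ j ih =>
    simp only [Function.iterate_succ_apply', fwdDiff]
    exact (ih (n + 1)).sub (ih n)

theorem hasPartial_update {f : (ℕ+ → ℝ) → 𝕜} {c : 𝕜} {s : ℕ+} {t : ℕ+ → ℝ} {τ : ℝ}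
    (hf : HasPartial f c s (Function.update t s τ)) :
    HasDerivAt (fun τ' => f (Function.update t s τ')) c τ := by
  simpa [HasPartial] using hf

end TimeLines

section Uniqueness

theorem eq_zero_of_periodic {y : ℤ → 𝕜} (hy : ∀ n, y (n + 1) = y n)
    (hy0 : Tendsto y atBot (𝓝 0)) (n : ℤ) : y n = 0 := by
  rw [← dInv_eq (f := fun _ => 0) summable_zero (fun n => by rw [hy, sub_self]) hy0 n, dInv,
    tsum_zero]

/-- The equation `g n κ (n + 1) = κ n g (n - r)` for the indeterminacy of a coefficient of the Lax
operator has only the zero solution among sequences that tend to zero at `-∞`: the product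
`κ n g (n - 1) ⋯ g (n - r)` is constant. -/
theorem eq_zero_of_mul_eq {g κ : ℤ → 𝕜} {c : 𝕜} {r : ℕ} (hg : ∀ n, g n ≠ 0)
    (hgc : Tendsto g atBot (𝓝 c)) (hκ0 : Tendsto κ atBot (𝓝 0))
    (hκ : ∀ n, g n * κ (n + 1) = κ n * g (n - r)) (n : ℤ) : κ n = 0 := by
  set y : ℤ → 𝕜 := fun n => κ n * ∏ i ∈ Finset.range r, g (n - 1 - i) with hy
  have hprod : ∀ n : ℤ, g n * ∏ i ∈ Finset.range r, g (n - 1 - i) =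
      (∏ i ∈ Finset.range r, g (n - i)) * g (n - r) := by
    intro n
    rw [← Finset.prod_range_succ (fun i : ℕ => g (n - i)), Finset.prod_range_succ', mul_comm]
    congr 1
    · refine Finset.prod_congr rfl fun i _ => ?_
      push_cast
      rw [sub_sub, add_comm (1 : ℤ)]
    · simp
  have h1 : ∀ n, y (n + 1) = y n := by
    intro n
    apply mul_right_cancel₀ (hg (n - r))
    simp only [hy, add_sub_cancel_right]
    rw [mul_assoc, ← hprod]
    linear_combination (∏ i ∈ Finset.range r, g (n - 1 - i)) * hκ n
  have h2 : Tendsto y atBot (𝓝 0) := by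
    have := hκ0.mul (tendsto_finsetProd (Finset.range r) fun i _ =>
      tendsto_atBot_add_const hgc (-1 - i))
    rw [zero_mul] at this
    refine this.congr fun n => ?_
    simp only [hy, add_sub_assoc', ← sub_eq_add_neg]
  have h3 := eq_zero_of_periodic h1 h2 n
  exact (mul_eq_zero.1 h3).resolve_right (Finset.prod_ne_zero_iff.2 fun i _ => hg _)

theorem norm_fwdDiff_iter_le {f : ℤ → 𝕜} {M : ℝ} (hf : ∀ n, ‖f n‖ ≤ M) (j : ℕ) (n : ℤ) :
    ‖((fwdDiff (1 : ℤ))^[j] f) n‖ ≤ 2 ^ j * M := by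
  induction j generalizing n with
  | zero => simpa using hf n
  | succ j ih =>
    rw [Function.iterate_succ_apply', fwdDiff, pow_succ]
    refine (norm_sub_le _ _).trans ?_
    linarith [ih (n + 1), ih n]

end Uniqueness

/-! ### The Lax operator and the flows -/

section LaxOperator

theorem PsdDiff.ker_add_one {R : Type*} [CommRing R] {P : PsdDiff R}
    (hP : ∀ j, 1 < j → P.coeff j = 0) (n : ℤ) : P.ker n (n + 1) = P.coeff 1 n := by
  rw [P.ker_eq_sum hP n (n + 1) (A := 1) (by omega) le_rfl]
  simp [shiftCoeff_one]

theorem posAct_of_banded_one {R : Type*} [CommRing R] {l : ℤ → ℤ → R} (hl : Banded 1 l)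
    (f : ℤ → R) (n : ℤ) : posAct l f n = l n (n + 1) * fwdDiff 1 f n := by
  have h1 := fun f : ℤ → R => rowTail_sub_one hl f n (n + 1)
  simp only [add_sub_cancel_right, rowTail_eq_zero hl _ (le_refl (n + 1)), add_zero] at h1
  rw [posAct, h1, h1, fwdDiff, Pi.one_apply]
  ring

theorem cornerSum_of_banded_one {R : Type*} [CommRing R] {l : ℤ → ℤ → R} (hl : Banded 1 l)
    (β : ℤ → R) (n : ℤ) : cornerSum l β 1 n = l n (n + 1) * β n := by
  have h1 := rowTail_sub_one hl 1 n (n + 1)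
  simp only [add_sub_cancel_right, rowTail_eq_zero hl _ (le_refl (n + 1)), add_zero] at h1
  have h2 : ∀ k, k ≤ n - 1 → β k * rowTail l 1 k n = 0 := fun k hk => by
    rw [rowTail_eq_zero hl 1 (by omega), mul_zero]
  rw [cornerSum, downSum_sub_one h2, downSum_eq_zero h2, h1, Pi.one_apply]
  ring

theorem lax_coeff_one {K : Type*} [Field K] {h : K} {a b vt : ℤ → K} {w : ℕ → ℤ → K}
    (hc : ∀ n, vt n = a n * b n) : (lax h vt w).coeff 1 = laxLead h a b := by
  funext n
  simp [lax, laxLead, hc, mul_assoc]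

theorem lax_coeff_neg {K : Type*} [Field K] (h : K) (vt : ℤ → K) (w : ℕ → ℤ → K) (i : ℕ) (n : ℤ) :
    (lax h vt w).coeff (-i) n = h ^ i * w i n := by
  simp only [lax]
  rw [if_neg (by omega), if_pos (by omega)]
  simp

theorem lax_coeff_of_lt {K : Type*} [Field K] (h : K) (vt : ℤ → K) (w : ℕ → ℤ → K) {j : ℤ}
    (hj : 1 < j) : (lax h vt w).coeff j = 0 := by
  funext n
  simp only [lax]
  rw [if_neg (by omega), if_neg (by omega)]
  rfl

theorem laxA_one_coeff {K : Type*} [Field K] (h : K) (vt : ℤ → K) (w : ℕ → ℤ → K) (j : ℤ) :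
    (laxA h vt w 1).coeff j = if j = 1 then (lax h vt w).coeff 1 else 0 := by
  simp only [laxA, PsdDiff.pow, PsdDiff.pos, PsdDiff.mul_one_coeff]
  rcases lt_trichotomy j 1 with h1 | rfl | h1
  · rw [if_neg (by omega), if_neg (by omega)]
  · simp
  · rw [if_pos (by omega), if_neg (by omega), lax_coeff_of_lt h vt w h1]

end LaxOperator

section Flows

variable {h : 𝕜} {U : Set (ℕ+ → ℝ)} {Φ Φs b : ℤ → (ℕ+ → ℝ) → 𝕜}

/-- The adjoint flow, summed up to a flow of `b = h E Δ⁻¹ Φ*`. -/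
theorem hasPartial_b (hU : LineOpen U) (hΦ : RapidDecay U Φ) (hΦs : RapidDecay U Φs)
    (hb : ∀ n t, b n t = h * dInv (fun k => Φs k t) (n + 1)) {t : ℕ+ → ℝ} (ht : t ∈ U) (s : ℕ+)
    {P : (ℕ+ → ℝ) → PsdDiff 𝕜} {p : ℕ} (hP : ∀ t j, (p : ℤ) < j → (P t).coeff j = 0)
    (hflow : ∀ t ∈ U, ∀ n, HasPartial (Φs n) (-(P t).pos.adjAct (fun k => Φs k t) n) s t)
    {C : ℝ} (hC0 : 0 ≤ C) (hC : ∀ᶠ τ in 𝓝 (t s), ∀ k m, k < m →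
      ‖(P (Function.update t s τ)).ker k m‖ ≤ C) (n : ℤ) :
    HasPartial (b n) (cornerSum (P t).ker (bwdDiff fun k => b k t) 1 n) s t := by
  obtain ⟨B, ω, hev⟩ := eventually_sliceBound hΦ hΦs hb ht s
  have hband : ∀ t, Banded p (P t).ker := fun t => PsdDiff.banded_ker (hP t)
  have hd : ∀ᶠ τ in 𝓝 (t s), ∀ n, HasDerivAt (fun τ' => Φs n (Function.update t s τ'))
      (bwdDiff (cornerSum (P (Function.update t s τ)).ker
        (fun k => Φs k (Function.update t s τ)) 1) n) τ := by
    filter_upwards [hU t ht s] with τ hτ n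
    have := hflow _ hτ n
    rw [PsdDiff.adjAct_pos_eq, neg_neg] at this
    exact hasPartial_update this
  have key := hasDerivAt_dInv (f := fun n τ => Φs n (Function.update t s τ))
    (l := fun τ => (P (Function.update t s τ)).ker) (hev.self_of_nhds.1.summable)
    (hev.mono fun τ hτ => hτ.2.1) (fun τ => hband _) hC0 hC hd n
  have hdiff := hev.self_of_nhds.2.2
  have key2 := key.const_mul h
  rw [← cornerSum_const_mul (hband _), ← hdiff] at key2
  simp only [Function.update_eq_self] at key2
  simpa only [HasPartial, hb] using key2

/-- The partial derivatives of the coefficients of `h⁻¹ (1 + h a b) Δ + a Δ⁻¹ b Δ` along the first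
flow are those of the Lax equation. -/
theorem hasPartial_constrainedLax (h0 : h ≠ 0) {a b : ℤ → (ℕ+ → ℝ) → 𝕜} {s : ℕ+} {t : ℕ+ → ℝ}
    (ha : ∀ n, HasPartial (a n)
      (laxLead h (fun k => a k t) (fun k => b k t) n * fwdDiff 1 (fun k => a k t) n) s t)
    (hb : ∀ n, HasPartial (b n)
      (laxLead h (fun k => a k t) (fun k => b k t) n * bwdDiff (fun k => b k t) n) s t)
    {A : PsdDiff 𝕜}
    (hA : ∀ j, A.coeff j = if j = 1 then laxLead h (fun k => a k t) (fun k => b k t) else 0)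
    {k : ℤ} (hk : k ≤ 1) (n : ℤ) :
    HasPartial (fun t => (constrainedLax h (fun k => a k t) (fun k => b k t)).coeff k n)
      ((A.mul (constrainedLax h (fun k => a k t) (fun k => b k t))).coeff k n -
        ((constrainedLax h (fun k => a k t) (fun k => b k t)).mul A).coeff k n) s t := by
  rcases hk.eq_or_lt with rfl | hk
  · rw [constrainedLax_commutator_one hA]
    simp only [constrainedLax_coeff_one, laxLead]
    have := ((((ha n).const_mul h).mul (hb n)).const_add 1).const_mul h⁻¹
    simp only [Function.update_eq_self] at this
    refine HasDerivAt.congr_deriv this ?_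
    simp only [laxLead]
    field_simp
  · obtain ⟨j, rfl⟩ : ∃ j : ℕ, k = -j := ⟨(-k).toNat, by omega⟩
    rw [constrainedLax_commutator_neg hA]
    simp only [constrainedLax_coeff_neg, symmetryCoeff]
    have h1 := hasDerivAt_fwdDiff_iter (f := fun n τ => b n (Function.update t s τ)) hb j
      (n - 1 - j)
    have := ((ha n).mul h1).const_mul ((-1) ^ j)
    simp only [Function.update_eq_self] at this
    exact this

/-- The Lax equation along the first flow and the decay at `-∞` determine the Lax operator. -/
theorem lax_eq_constrainedLax (h0 : h ≠ 0) (hU : LineOpen U) {a b : ℤ → (ℕ+ → ℝ) → 𝕜}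
    (hbound : ∀ t ∈ U, ∃ (B : ℝ) (ω : ℤ → ℝ), SliceBound B ω (fun n => a n t) fun n => b n t)
    {vt : ℤ → (ℕ+ → ℝ) → 𝕜} {w : ℕ → ℤ → (ℕ+ → ℝ) → 𝕜} {L A : (ℕ+ → ℝ) → PsdDiff 𝕜}
    (hL : ∀ t, L t = lax h (fun n => vt n t) fun j n => w j n t)
    (hA : ∀ t, A t = laxA h (fun n => vt n t) (fun j n => w j n t) 1)
    (hv : ∀ t ∈ U, ∀ n, 1 + h * vt n t ≠ 0)
    (hx : ∀ t ∈ U, ∀ k n, HasPartial (fun t' => (L t').coeff k n)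
      (((A t).mul (L t)).coeff k n - ((L t).mul (A t)).coeff k n) 1 t)
    (hw : ∀ t ∈ U, ∀ j, Tendsto (fun n => w j n t) atBot (𝓝 0))
    (hc : ∀ t ∈ U, ∀ n, vt n t = a n t * b n t)
    (ha : ∀ t ∈ U, ∀ n, HasPartial (a n)
      (laxLead h (fun k => a k t) (fun k => b k t) n * fwdDiff 1 (fun k => a k t) n) 1 t)
    (hb : ∀ t ∈ U, ∀ n, HasPartial (b n)
      (laxLead h (fun k => a k t) (fun k => b k t) n * bwdDiff (fun k => b k t) n) 1 t)
    {t : ℕ+ → ℝ} (ht : t ∈ U) :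
    L t = constrainedLax h (fun k => a k t) fun k => b k t := by
  have hLlt : ∀ t j, 1 < j → (L t).coeff j = 0 := fun t j hj => by
    rw [hL, lax_coeff_of_lt _ _ _ hj]
  have hAc : ∀ t ∈ U, ∀ j, (A t).coeff j =
      if j = 1 then laxLead h (fun k => a k t) (fun k => b k t) else 0 := fun t ht j => by
    rw [hA, laxA_one_coeff, lax_coeff_one (hc t ht)]
  -- the coefficients agree from `Δ` downwards
  have main : ∀ i : ℕ, ∀ t ∈ U, ∀ j : ℤ, 1 - i ≤ j →
      (L t).coeff j = (constrainedLax h (fun k => a k t) fun k => b k t).coeff j := by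
    intro i
    induction i with
    | zero =>
      intro t ht j hj
      rcases (show (1 : ℤ) ≤ j by simpa using hj).eq_or_lt with rfl | hj
      · rw [hL, lax_coeff_one (hc t ht), constrainedLax_coeff_one]
      · rw [hLlt t j hj, constrainedLax_coeff_of_lt _ _ _ hj]
    | succ i ih =>
      intro t ht j hj
      rcases (show (1 : ℤ) - (i + 1) ≤ j by simpa using hj).lt_or_eq with hj | hj
      · exact ih t ht j (by omega)
      obtain ⟨B, ω, H⟩ := hbound t ht
      set M := constrainedLax h (fun k => a k t) fun k => b k t with hM
      funext n
      have hk : (1 : ℤ) - i ≤ 1 := by omega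
      have hji : j = -(i : ℤ) := by omega
      have hder : ∀ n, ((A t).mul (L t)).coeff (1 - i) n - ((L t).mul (A t)).coeff (1 - i) n =
          ((A t).mul M).coeff (1 - i) n - (M.mul (A t)).coeff (1 - i) n := by
        intro n
        have h1 := hx t ht (1 - i) n
        have h2 := hasPartial_constrainedLax h0 (ha t ht) (hb t ht) (hAc t ht) hk n
        refine HasDerivAt.unique h1 (h2.congr_of_eventuallyEq ?_)
        filter_upwards [hU t ht 1] with τ hτ
        exact congrFun (ih _ hτ (1 - i) le_rfl) n
      have hκ := fun n => PsdDiff.commutator_sub_commutator (hAc t ht) (hLlt t)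
        (fun j hj => constrainedLax_coeff_of_lt h (fun k => a k t) (fun k => b k t) hj) hk
        (fun j hj => ih t ht j hj) n
      rw [show (1 : ℤ) - i - 1 = j by omega] at hκ
      refine sub_eq_zero.1 (eq_zero_of_mul_eq (r := i)
        (g := laxLead h (fun k => a k t) fun k => b k t)
        (κ := fun n => (L t).coeff j n - M.coeff j n) (fun n => ?_)
        (H.tendsto_laxLead_atBot h) ?_ (fun n => ?_) n)
      · have := hv t ht n
        rw [hc t ht, ← mul_assoc] at this
        exact mul_ne_zero (inv_ne_zero h0) this
      · have h1 := (hw t ht i).const_mul (h ^ i)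
        have h2 := (tendsto_zero_mul_of_norm_le (tendsto_atBot_zero_of_summable H.summable_a)
          (g := fun n => ((fwdDiff (1 : ℤ))^[i] fun k => b k t) (n - 1 - i))
          fun n => norm_fwdDiff_iter_le H.norm_b_le i _).const_mul ((-1 : 𝕜) ^ i)
        have h3 := h1.sub h2
        rw [mul_zero, mul_zero, sub_zero] at h3
        refine h3.congr fun n => ?_
        rw [hji, hL, lax_coeff_neg, hM, constrainedLax_coeff_neg, symmetryCoeff]
      · have h1 := hκ n
        rw [hder n, sub_self] at h1
        rw [show n - (i : ℤ) = n + (1 - i) - 1 by ring]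
        exact (sub_eq_zero.1 h1.symm)
  refine PsdDiff.ext (funext fun j => ?_)
  exact main (1 - j).toNat t ht j (by omega)

end Flows

end

end DDCLL

theorem theorem6 {𝕜 : Type*} [RCLike 𝕜] (h : 𝕜) (h0 : h ≠ 0)
    -- the domain of the times `t = (t₁, t₂, …)`; the variable `x` is `t₁`
    (U : Set (ℕ+ → ℝ)) (hU : DDCLL.LineOpen U)
    -- the eigenfunction `Φ` and the adjoint eigenfunction `Φ*`
    (Φ Φs : ℤ → (ℕ+ → ℝ) → 𝕜)
    (hΦ : DDCLL.RapidDecay U Φ) (hΦs : DDCLL.RapidDecay U Φs)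
    -- the coefficients `ṽ` and `v₀, v₁, …` of the Lax operator `L`
    (vt : ℤ → (ℕ+ → ℝ) → 𝕜) (w : ℕ → ℤ → (ℕ+ → ℝ) → 𝕜)
    (L : (ℕ+ → ℝ) → DDCLL.PsdDiff 𝕜)
    (hL : ∀ t, L t = DDCLL.lax h (fun n => vt n t) (fun j n => w j n t))
    (A : ℕ → (ℕ+ → ℝ) → DDCLL.PsdDiff 𝕜)
    (hA : ∀ s t, A s t = DDCLL.laxA h (fun n => vt n t) (fun j n => w j n t) s)
    -- the leading coefficient `v = 1 + h ṽ` does not vanish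
    (hv : ∀ t ∈ U, ∀ n, 1 + h * vt n t ≠ 0)
    -- `L_x = [A₁, L]` and decay at `-∞` determine `v₀, v₁, …` from `ṽ`
    (hx : ∀ t ∈ U, ∀ k n, DDCLL.HasPartial (fun t' => (L t').coeff k n)
      (((A 1 t).mul (L t)).coeff k n - ((L t).mul (A 1 t)).coeff k n) 1 t)
    (hw : ∀ t ∈ U, ∀ j, Tendsto (fun n => w j n t) atBot (𝓝 0))
    -- the flows `Φ_{t_s} = A_s Φ` and `Φ*_{t_s} = -A_s* Φ*`
    (hflow : ∀ t ∈ U, ∀ (s : ℕ+) (n : ℤ),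
      DDCLL.HasPartial (Φ n) ((A s t).act (fun k => Φ k t) n) s t)
    (hflows : ∀ t ∈ U, ∀ (s : ℕ+) (n : ℤ),
      DDCLL.HasPartial (Φs n) (-(A s t).adjAct (fun k => Φs k t) n) s t)
    -- `a = Φ`, `b = h E Δ⁻¹ Φ*`, and the constraint `ṽ = h Φ E Δ⁻¹ Φ* = a b`
    (a b : ℤ → (ℕ+ → ℝ) → 𝕜) (ha : ∀ n t, a n t = Φ n t)
    (hb : ∀ n t, b n t = h * DDCLL.dInv (fun k => Φs k t) (n + 1))
    (hc : ∀ t ∈ U, ∀ n, vt n t = a n t * b n t) :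
    -- the initial equation
    (∀ t ∈ U, ∀ n,
      DDCLL.HasPartial (a n)
        (h⁻¹ * (1 + h * a n t * b n t) * (a (n + 1) t - a n t)) 1 t ∧
      DDCLL.HasPartial (b n)
        (h⁻¹ * (1 + h * a n t * b n t) * (b n t - b (n - 1) t)) 1 t) ∧
    -- the recursion `(a, b)_{t_{s+1}} = T (a, b)_{t_s}`; all sums in it converge
    (∀ t ∈ U, ∀ s : ℕ+,
      DDCLL.TDefined h (fun k => a k t) (fun k => b k t)
        (fun k => DDCLL.partialD (a k) s t) (fun k => DDCLL.partialD (b k) s t) ∧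
      ∀ n,
        DDCLL.HasPartial (a n)
          (DDCLL.T11 h (fun k => a k t) (fun k => b k t) (fun k => DDCLL.partialD (a k) s t) n
            + DDCLL.T12 h (fun k => a k t) (fun k => b k t)
                (fun k => DDCLL.partialD (b k) s t) n) (s + 1) t ∧
        DDCLL.HasPartial (b n)
          (DDCLL.T21 h (fun k => a k t) (fun k => b k t) (fun k => DDCLL.partialD (a k) s t) n
            + DDCLL.T22 h (fun k => a k t) (fun k => b k t)
                (fun k => DDCLL.partialD (b k) s t) n) (s + 1) t) := by
  obtain rfl : a = Φ := funext fun n => funext fun t => ha n t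
  have hbound : ∀ t ∈ U, ∃ (B : ℝ) (ω : ℤ → ℝ),
      DDCLL.SliceBound B ω (fun n => a n t) fun n => b n t := by
    intro t ht
    obtain ⟨B, ω, hev⟩ := DDCLL.eventually_sliceBound hΦ hΦs hb ht 1
    have := hev.self_of_nhds.1
    simp only [Function.update_eq_self] at this
    exact ⟨B, ω, this⟩
  have hLlt : ∀ t j, 1 < j → (L t).coeff j = 0 := fun t j hj => by
    rw [hL, DDCLL.lax_coeff_of_lt _ _ _ hj]
  have hband : ∀ t, DDCLL.Banded 1 (L t).ker := fun t => DDCLL.PsdDiff.banded_ker (hLlt t)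
  have hApos : ∀ s t, A s t = ((L t).pow s).pos := fun s t => by rw [hA, hL]; rfl
  have ha_flow : ∀ t ∈ U, ∀ (s : ℕ+) (n : ℤ), DDCLL.HasPartial (a n)
      (DDCLL.posAct ((L t).pow s).ker (fun k => a k t) n) s t := fun t ht s n => by
    have := hflow t ht s n
    rwa [hApos, DDCLL.PsdDiff.act_pos_eq_posAct] at this
  have hb_flow : ∀ t ∈ U, ∀ (s : ℕ+) (C : ℝ), 0 ≤ C → (∀ᶠ τ in 𝓝 (t s), ∀ k m, k < m →
      ‖((L (Function.update t s τ)).pow s).ker k m‖ ≤ C) → ∀ n, DDCLL.HasPartial (b n)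
      (DDCLL.cornerSum ((L t).pow s).ker (DDCLL.bwdDiff fun k => b k t) 1 n) s t :=
    fun t ht s C hC0 hC n => DDCLL.hasPartial_b hU hΦ hΦs hb ht s (P := fun t => (L t).pow s)
      (fun t => DDCLL.PsdDiff.pow_coeff_of_lt (hLlt t) s)
      (fun t ht n => by
        have := hflows t ht s n
        rwa [hApos] at this) hC0 hC n
  -- the first flow needs the leading coefficient of `L` only
  have hlead : ∀ t ∈ U, ∀ n, (L t).ker n (n + 1) =
      DDCLL.laxLead h (fun k => a k t) (fun k => b k t) n := fun t ht n => by
    rw [DDCLL.PsdDiff.ker_add_one (hLlt t), hL, DDCLL.lax_coeff_one (hc t ht)]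
  have hker1 : ∀ t, ((L t).pow ((1 : ℕ+) : ℕ)).ker = (L t).ker := fun t => by
    rw [PNat.one_coe, DDCLL.PsdDiff.ker_pow, DDCLL.kerPow_one]
  have ha1 : ∀ t ∈ U, ∀ n, DDCLL.HasPartial (a n)
      (DDCLL.laxLead h (fun k => a k t) (fun k => b k t) n * fwdDiff 1 (fun k => a k t) n)
      1 t := fun t ht n => by
    have := ha_flow t ht 1 n
    rwa [hker1, DDCLL.posAct_of_banded_one (hband t), hlead t ht] at this
  have hb1 : ∀ t ∈ U, ∀ n, DDCLL.HasPartial (b n)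
      (DDCLL.laxLead h (fun k => a k t) (fun k => b k t) n *
        DDCLL.bwdDiff (fun k => b k t) n) 1 t := fun t ht n => by
    obtain ⟨B, ω, hev⟩ := DDCLL.eventually_sliceBound hΦ hΦs hb ht 1
    have hB := hev.self_of_nhds.1.bound_nonneg
    have := hb_flow t ht 1 (‖h⁻¹‖ * (1 + ‖h‖ * B * B)) (by positivity) (by
      filter_upwards [hev, hU t ht 1] with τ hτ hτU k m hkm
      rw [hker1]
      rcases (show k + 1 ≤ m from hkm).eq_or_lt with rfl | hkm
      · rw [hlead _ hτU]
        exact hτ.1.norm_laxLead_le h k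
      · rw [hband _ k m hkm, norm_zero]
        positivity) n
    rwa [hker1, DDCLL.cornerSum_of_banded_one (hband t), hlead t ht] at this
  refine ⟨fun t ht n => ⟨ha1 t ht n, hb1 t ht n⟩, fun t ht s => ?_⟩
  have hLc : ∀ t ∈ U, L t = DDCLL.constrainedLax h (fun k => a k t) fun k => b k t :=
    fun t ht => DDCLL.lax_eq_constrainedLax h0 hU hbound hL (hA 1) hv hx hw hc ha1 hb1 ht
  have hker : ∀ t ∈ U, ∀ s : ℕ, ((L t).pow s).ker =
      DDCLL.kerPow (DDCLL.laxKer h (fun k => a k t) fun k => b k t) s := fun t ht s => by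
    rw [DDCLL.PsdDiff.ker_pow, hLc t ht, DDCLL.ker_constrainedLax]
  have ha' : ∀ (s : ℕ+) n, DDCLL.HasPartial (a n) (DDCLL.posAct (DDCLL.kerPow
      (DDCLL.laxKer h (fun k => a k t) fun k => b k t) s) (fun k => a k t) n) s t :=
    fun s n => hker t ht s ▸ ha_flow t ht s n
  have hb' : ∀ (s : ℕ+) n, DDCLL.HasPartial (b n) (DDCLL.cornerSum (DDCLL.kerPow
      (DDCLL.laxKer h (fun k => a k t) fun k => b k t) s)
      (DDCLL.bwdDiff fun k => b k t) 1 n) s t := by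
    intro s n
    obtain ⟨B, ω, hev⟩ := DDCLL.eventually_sliceBound hΦ hΦs hb ht s
    obtain ⟨C, hC0, hC⟩ := DDCLL.exists_norm_kerPow_le h B ω s
    have := hb_flow t ht s C hC0 (by
      filter_upwards [hev, hU t ht s] with τ hτ hτU k m _
      rw [hker _ hτU]
      exact hC _ _ hτ.1 k m) n
    rwa [hker t ht] at this
  obtain ⟨B, ω, H⟩ := hbound t ht
  obtain ⟨hdef, hrec⟩ := H.recursion h0 (fun n => by
      have := hv t ht n
      rwa [hc t ht, ← mul_assoc] at this) s.ne_zero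
    (u := fun k => DDCLL.partialD (a k) s t) (w := fun k => DDCLL.partialD (b k) s t)
    (funext fun k => (ha' s k).deriv) (funext fun k => (hb' s k).deriv)
  refine ⟨hdef, fun n => ?_⟩
  rw [(hrec n).1, (hrec n).2]
  exact ⟨ha' (s + 1) n, hb' (s + 1) n⟩
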